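/- Theorem 3. Consider a complete network on $n$ nodes that operates in synchronous rounds; all nodes start simultaneously and run the same randomized algorithm $A$, which may depend on $n$. Every node has $n-1$ ports, connected to the other $n-1$ nodes by a bijection that the node does not know; these bijections are uniformly random and independent for different nodes. Every node has its own infinite sequence of unbiased coin flips, all flips being independent of each other and of the ports. In each round a node may send one message of arbitrary size on each of its ports; it receives the messages sent to it in that round, each on the port that leads to its sender, and then updates its state by an arbitrary local computation. Each node has a status in $\{\bot,\text{NON-ELECTED},\text{ELECTED}\}$, and a run solves leader election if, from some round on, exactly one node has status ELECTED and all other nodes have status NON-ELECTED. Let $f:\mathbb{N}\to\mathbb{R}$, and let $\varepsilon>0$ and $a>0$ be constants. Suppose that for all sufficiently large $n$, on the complete network of $n$ nodes, $A$ sends at most $f(n)$ messages in total with probability at least $1-n^{-a}$, and $A$ solves leader election with probability at least $1/e+\varepsilon$. Then $f(n)\in\Omega(\sqrt n)$, i.e. there is a constant $c>0$ with $f(n)\ge c\sqrt n$ for all sufficiently large $n$. This holds for anonymous nodes, and also if the nodes are equipped with unique identifiers chosen by an adversary. In the latter case every node initially knows its own identifier, the identifiers come from a set $I_n$ with $|I_n|\ge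 n^4$ for all sufficiently large $n$, and the two probability bounds are assumed, for all sufficiently large $n$, for every assignment of pairwise distinct identifiers from $I_n$ to the $n$ nodes (the assignment being fixed before ports and coins are drawn). -/

import Mathlib

open MeasureTheory Filter

namespace LeaderElection

/-- The value of the status variable of a node. -/
inductive Status where
  | undecided
  | nonElected
  | elected

/-- An infinite sequence of private coin flips of a node. -/
abbrev Tape : Type := ℕ → Bool

/-- A randomized synchronous algorithm for the nodes of a complete network with `n` nodes, every
node being given an input from `I` (an identifier; `I = Unit` for anonymous nodes). All nodes run
the same code, which may depend on `n`. A node sees its input, its private coin flips, and, round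
by round, the messages that arrive on its `n - 1` ports; it does not know where its ports lead.
In each round it may send one message of arbitrary size on each of its ports, `none` meaning that
nothing is sent. Neither the local computation nor the number of rounds is restricted. -/
structure Algorithm (n : ℕ) (I : Type) where
  /-- local states -/
  State : Type
  /-- messages, for instance all finite bit strings -/
  Msg : Type
  [measurableSpaceState : MeasurableSpace State]
  [countableMsg : Countable Msg]
  /-- the state before the first round; the state may keep the coin flips for later use -/
  init : I → Tape → State
  /-- the message sent on each port in a round that is begun in the given state -/
  send : State → Fin (n - 1) → Option Msg
  /-- the state after a round that is begun in the given state and in which the given messages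
  arrive on the ports -/
  recv : State → (Fin (n - 1) → Option Msg) → State
  /-- the status variable -/
  status : State → Status
  measurable_init : ∀ i, Measurable (init i)
  measurableSet_send : ∀ p m, MeasurableSet {s | send s p = m}
  measurable_recv : ∀ inbox, Measurable fun s => recv s inbox
  measurableSet_status : ∀ x, MeasurableSet {s | status s = x}

/-- A port assignment of the complete network on `Fin n`: for every node `v`, a bijection from the
ports of `v` to the other nodes. The assignments at different nodes are unrelated. -/
abbrev Ports (n : ℕ) : Type := ∀ v : Fin n, Fin (n - 1) ≃ {w : Fin n // w ≠ v}

instance (n : ℕ) : Nonempty (Ports n) :=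
  ⟨fun v => Fintype.equivOfCardEq (by simp [Fintype.card_subtype_compl])⟩

instance (n : ℕ) : MeasurableSpace (Ports n) := ⊤

/-- What chance decides in a run: the port assignment and the coin flips of every node. -/
abbrev Outcome (n : ℕ) : Type := Ports n × (Fin n → Tape)

/-- Independent unbiased coin flips. -/
noncomputable def tapeMeasure : Measure Tape :=
  Measure.infinitePi fun _ : ℕ => (PMF.uniformOfFintype Bool).toMeasure

/-- The port assignment is uniformly random (so the bijections at the nodes are independent and
uniform), and independently of it all nodes have independent unbiased coin flips. -/
noncomputable def runMeasure (n : ℕ) : Measure (Outcome n) :=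
  (PMF.uniformOfFintype (Ports n)).toMeasure.prod (Measure.pi fun _ : Fin n => tapeMeasure)

namespace Algorithm

variable {n : ℕ} {I : Type}

/-- The states of all nodes after `t` rounds. In each round the message that node `v` receives on
its port `p`, leading to `w`, is the one that `w` sends in this round on its port leading to `v`. -/
def state (A : Algorithm n I) (ids : Fin n → I) (x : Outcome n) : ℕ → Fin n → A.State
  | 0 => fun v => A.init (ids v) (x.2 v)
  | t + 1 => fun v =>
      A.recv (A.state ids x t v) fun p =>
        A.send (A.state ids x t (x.1 v p))
          ((x.1 (x.1 v p)).symm ⟨v, (x.1 v p).2.symm⟩)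

/-- The number of messages sent in the first `r` rounds. -/
def messages (A : Algorithm n I) (ids : Fin n → I) (x : Outcome n) (r : ℕ) : ℕ :=
  ∑ t ∈ Finset.range r, ∑ v : Fin n,
    (Finset.univ.filter fun p => (A.send (A.state ids x t v) p).isSome).card

/-- The event that at most `b` messages are sent in the whole run. -/
def sendsAtMost (A : Algorithm n I) (ids : Fin n → I) (b : ℝ) : Set (Outcome n) :=
  {x | ∀ r, (A.messages ids x r : ℝ) ≤ b}

/-- The event that leader election is solved: from some round on, exactly one node has status
`elected` and all other nodes have status `nonElected`. -/
def electsLeader (A : Algorithm n I) (ids : Fin n → I) : Set (Outcome n) :=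
  {x | ∃ T, ∀ t, T ≤ t → ∃ v, A.status (A.state ids x t v) = Status.elected ∧
    ∀ w, w ≠ v → A.status (A.state ids x t w) = Status.nonElected}

end Algorithm

end LeaderElection

/-! A node that no message reaches is governed by its own seed alone. Fix a late time `t` and call a
seed quiet if such a node stays silent and ends non-elected. In a successful run with at most `m`
messages at most `2 * m + 1` nodes are active, that is, not quiet (`ElectsCheaply.card_active_le`),
so active nodes and message receivers together number at most `3 * m + 1`. If `m` is small against
`√n`, the parts of the network that grow around different active nodes are disjoint with high
probability and evolve independently. A leader then requires that exactly one part contains an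
elected node. For `n` independent, identically distributed parts this has probability at most `n * p
* (1 - p) ^ (n - 1)`, hence at most `n / (n - 1)` times `1 / e`.

Independence is made exact by counting over a finite set of seeds. A family consists of one
configuration (row) per node `i`, in which only `i` may be active, and one row without active nodes.
Its `overlay` is uniformly distributed (`exists_card_overlay`). If the clouds of the rows are
disjoint, `shuffle` brings them into the overlay, which is then glued from the rows
(`glued_overlay_shuffle`) and runs on each cloud as the row does (`Glued.run_eq_and_touched_eq`). On
such families shuffling is injective, because the clouds can be recovered from the result
(`cloud_eq_of_shuffle_eq`). Symmetry under renaming makes collisions of clouds rare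
(`card_collisions_le`), and `card_electsCheaply_le` combines these facts.

Infinite tapes and identifiers reduce to finite seeds by sampling: the nodes draw uniformly from a
pool of `n ^ 4` pairs of an input and a random tape. The finite bound applies to every fixed pool,
while the draws are distinct except with probability at most `1 / n ^ 2`, and distinct draws see
independent tapes (`mul_descFactorial_le`). -/

namespace LeaderElection

/-! ### Runs from seeds; quiet, active and touched nodes -/

/-- A configuration fixes, for every node, its seed and its port bijection. -/
abbrev Config (n : ℕ) (S : Type) : Type :=
  ∀ v : Fin n, S × (Fin (n - 1) ≃ {w : Fin n // w ≠ v})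

/-- The port of `v` that leads to `w`. -/
def Config.port {n : ℕ} {S : Type} (x : Config n S) (v w : Fin n) (h : w ≠ v) : Fin (n - 1) :=
  (x v).2.symm ⟨w, h⟩

theorem Config.port_congr {n : ℕ} {S : Type} (x : Config n S) {v v' w w' : Fin n} (hv : v = v')
    (hw : w = w') (h : w ≠ v) (h' : w' ≠ v') : x.port v w h = x.port v' w' h' := by
  subst hv hw
  rfl

theorem Config.apply_congr {n : ℕ} {S : Type} (x : Config n S) {v v' : Fin n} (h : v = v')
    (p : Fin (n - 1)) : ((x v).2 p : Fin n) = (x v').2 p := by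
  subst h
  rfl

namespace Algorithm

variable {n : ℕ} {I S : Type} (A : Algorithm n I) (s₀ : S → A.State)

/-- The states of all nodes after `t` rounds if a node with seed `s` starts in state `s₀ s`. -/
def run (x : Config n S) : ℕ → Fin n → A.State
  | 0 => fun v => s₀ (x v).1
  | t + 1 => fun v =>
      A.recv (run x t v) fun p =>
        A.send (run x t ((x v).2 p)) (x.port ((x v).2 p) v ((x v).2 p).2.symm)

/-- The states of a node that never receives a message. -/
def idle (s : S) : ℕ → A.State
  | 0 => s₀ s
  | t + 1 => A.recv (idle s t) fun _ => none

/-- A seed is quiet if a node with this seed that receives nothing sends nothing in the first `t`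
rounds and has status `nonElected` afterwards. -/
def Quiet (t : ℕ) (s : S) : Prop :=
  (∀ r < t, ∀ p, A.send (A.idle s₀ s r) p = none) ∧
    A.status (A.idle s₀ s t) = Status.nonElected

/-- The number of messages that `v` sends in round `r`. -/
def sentBy (x : Config n S) (r : ℕ) (v : Fin n) : ℕ :=
  (Finset.univ.filter fun p => (A.send (A.run s₀ x r v) p).isSome).card

/-- The number of messages sent in the first `r` rounds. -/
def sent (x : Config n S) (r : ℕ) : ℕ :=
  ∑ k ∈ Finset.range r, ∑ v, A.sentBy s₀ x k v

open Classical in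
/-- The nodes with a seed that is not quiet. -/
noncomputable def active (t : ℕ) (x : Config n S) : Finset (Fin n) :=
  Finset.univ.filter fun v => ¬ A.Quiet s₀ t (x v).1

open Classical in
/-- The nodes to which some node of `T` sends a message in round `r`. -/
noncomputable def targets (x : Config n S) (r : ℕ) (T : Finset (Fin n)) : Finset (Fin n) :=
  Finset.univ.filter fun w =>
    ∃ v ∈ T, ∃ p, (A.send (A.run s₀ x r v) p).isSome ∧ ((x v).2 p : Fin n) = w

/-- The active nodes and those reached by messages in the first `r` rounds. -/
noncomputable def touched (t : ℕ) (x : Config n S) : ℕ → Finset (Fin n)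
  | 0 => A.active s₀ t x
  | r + 1 => touched t x r ∪ A.targets s₀ x r (touched t x r)

variable {A s₀} {t : ℕ}

theorem mem_active {x : Config n S} {v : Fin n} :
    v ∈ A.active s₀ t x ↔ ¬ A.Quiet s₀ t (x v).1 := by
  simp [active]

theorem mem_targets {x : Config n S} {r : ℕ} {T : Finset (Fin n)} {w : Fin n} :
    w ∈ A.targets s₀ x r T ↔
      ∃ v ∈ T, ∃ p, (A.send (A.run s₀ x r v) p).isSome ∧ ((x v).2 p : Fin n) = w := by
  simp [targets]

theorem touched_subset_succ (x : Config n S) (r : ℕ) :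
    A.touched s₀ t x r ⊆ A.touched s₀ t x (r + 1) :=
  Finset.subset_union_left

theorem touched_mono (x : Config n S) : Monotone (A.touched s₀ t x) :=
  monotone_nat_of_le_succ (touched_subset_succ x)

theorem active_subset_touched (x : Config n S) (r : ℕ) :
    A.active s₀ t x ⊆ A.touched s₀ t x r :=
  touched_mono x (Nat.zero_le r)

theorem quiet_of_notMem_touched {x : Config n S} {r : ℕ} {v : Fin n}
    (hv : v ∉ A.touched s₀ t x r) : A.Quiet s₀ t (x v).1 := by
  by_contra h
  exact hv (active_subset_touched x r (mem_active.2 h))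

theorem touched_eq_empty {x : Config n S} (h : ∀ v, A.Quiet s₀ t (x v).1) (r : ℕ) :
    A.touched s₀ t x r = ∅ := by
  induction r with
  | zero => ext v; simp [touched, mem_active, h v]
  | succ r ih =>
    ext w
    simp [touched, ih, mem_targets]

/-- A sender in round `r` must be touched, since an untouched node is idle by induction and quiet
seeds are silent before round `t`. Its receiver is then touched in the next round. -/
theorem run_of_notMem_touched {x : Config n S} {r : ℕ} (hr : r ≤ t) {v : Fin n}
    (hv : v ∉ A.touched s₀ t x r) : A.run s₀ x r v = A.idle s₀ (x v).1 r := by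
  induction r generalizing v with
  | zero => rfl
  | succ r ih =>
    have hv' : v ∉ A.touched s₀ t x r := fun h => hv (touched_subset_succ x r h)
    simp only [run, idle, ih (by omega) hv']
    congr 1
    funext p
    by_contra hne
    set w : Fin n := ((x v).2 p : Fin n) with hw
    have hsome : (A.send (A.run s₀ x r w) (x.port w v ((x v).2 p).2.symm)).isSome :=
      Option.isSome_iff_ne_none.2 hne
    have hwT : w ∈ A.touched s₀ t x r := by
      by_contra hwT
      rw [ih (by omega) hwT, (quiet_of_notMem_touched hwT).1 r (by omega)] at hsome
      simp at hsome
    refine hv (Finset.mem_union_right _ (mem_targets.2 ⟨w, hwT, _, hsome, ?_⟩))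
    simp [Config.port]

theorem send_of_notMem_touched {x : Config n S} {r : ℕ} (hr : r < t) {v : Fin n}
    (hv : v ∉ A.touched s₀ t x r) (p : Fin (n - 1)) : A.send (A.run s₀ x r v) p = none := by
  rw [run_of_notMem_touched hr.le hv]
  exact (quiet_of_notMem_touched hv).1 r hr p

theorem sentBy_of_notMem_touched {x : Config n S} {r : ℕ} (hr : r < t) {v : Fin n}
    (hv : v ∉ A.touched s₀ t x r) : A.sentBy s₀ x r v = 0 := by
  simp [sentBy, send_of_notMem_touched hr hv]

theorem status_of_notMem_touched {x : Config n S} {v : Fin n}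
    (hv : v ∉ A.touched s₀ t x t) : A.status (A.run s₀ x t v) = Status.nonElected := by
  rw [run_of_notMem_touched le_rfl hv]
  exact (quiet_of_notMem_touched hv).2

theorem sent_succ (x : Config n S) (r : ℕ) :
    A.sent s₀ x (r + 1) = A.sent s₀ x r + ∑ v, A.sentBy s₀ x r v :=
  Finset.sum_range_succ _ _

theorem sent_mono (x : Config n S) : Monotone (A.sent s₀ x) :=
  monotone_nat_of_le_succ fun r => by rw [sent_succ]; omega

theorem card_targets_le (x : Config n S) (r : ℕ) (T : Finset (Fin n)) :
    (A.targets s₀ x r T).card ≤ ∑ v, A.sentBy s₀ x r v := by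
  classical
  calc (A.targets s₀ x r T).card
      ≤ (Finset.univ.biUnion fun v => (Finset.univ.filter fun p =>
          (A.send (A.run s₀ x r v) p).isSome).image fun p => ((x v).2 p : Fin n)).card := by
        refine Finset.card_le_card fun w hw => ?_
        obtain ⟨v, -, p, hp, rfl⟩ := mem_targets.1 hw
        exact Finset.mem_biUnion.2 ⟨v, Finset.mem_univ _,
          Finset.mem_image.2 ⟨p, by simpa using hp, rfl⟩⟩
    _ ≤ ∑ v, A.sentBy s₀ x r v :=
        Finset.card_biUnion_le.trans (Finset.sum_le_sum fun v _ => Finset.card_image_le)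

/-- Every newly touched node costs at least one message. -/
theorem card_touched_le (x : Config n S) (r : ℕ) :
    (A.touched s₀ t x r).card ≤ (A.active s₀ t x).card + A.sent s₀ x r := by
  induction r with
  | zero => simp [touched]
  | succ r ih =>
    have h1 := card_targets_le (A := A) (s₀ := s₀) x r (A.touched s₀ t x r)
    have h2 := Finset.card_union_le (A.touched s₀ t x r)
      (A.targets s₀ x r (A.touched s₀ t x r))
    rw [sent_succ]
    simp only [touched]
    omega

/-! ### Gluing runs with disjoint touched sets -/

/-- `z` is glued from the touched parts of the configurations `c i`: these are disjoint, `z` agrees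
with `c i` on the `i`-th part, and is quiet outside of all parts. -/
structure Glued {ι : Type} (A : Algorithm n I) (s₀ : S → A.State) (t : ℕ) (c : ι → Config n S)
    (z : Config n S) (r : ℕ) : Prop where
  disjoint : ∀ i j v, v ∈ A.touched s₀ t (c i) r → v ∈ A.touched s₀ t (c j) r → i = j
  agree : ∀ i v, v ∈ A.touched s₀ t (c i) r → z v = c i v
  quiet : ∀ v, (∀ i, v ∉ A.touched s₀ t (c i) r) → A.Quiet s₀ t (z v).1

namespace Glued

variable {ι : Type} {c : ι → Config n S} {z : Config n S}

theorem anti {r k : ℕ} (hk : k ≤ r) (h : Glued A s₀ t c z r) : Glued A s₀ t c z k where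
  disjoint i j v hi hj := h.disjoint i j v (touched_mono _ hk hi) (touched_mono _ hk hj)
  agree i v hi := h.agree i v (touched_mono _ hk hi)
  quiet v hv := by
    by_cases hr : ∀ i, v ∉ A.touched s₀ t (c i) r
    · exact h.quiet v hr
    -- A node touched only after round `k` is not active in its row, so the seed it passes to `z` is
    -- quiet.
    · push Not at hr
      obtain ⟨i, hi⟩ := hr
      rw [h.agree i v hi]
      exact quiet_of_notMem_touched (hv i)

/-- Both claims go through one induction: equal states give equal messages, hence equal targets, and
the touched set of `z` tells which of its nodes are still idle. -/
theorem run_eq_and_touched_eq {r : ℕ} (hr : r ≤ t) (h : Glued A s₀ t c z r) :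
    (∀ i, ∀ v ∈ A.touched s₀ t (c i) r, A.run s₀ z r v = A.run s₀ (c i) r v) ∧
      ∀ v, v ∈ A.touched s₀ t z r ↔ ∃ i, v ∈ A.touched s₀ t (c i) r := by
  induction r with
  | zero =>
    refine ⟨fun i v hv => by simp [run, h.agree i v hv], fun v => ⟨fun hv => ?_, ?_⟩⟩
    · by_contra hne
      push Not at hne
      exact mem_active.1 hv (h.quiet v hne)
    · rintro ⟨i, hi⟩
      have := mem_active.1 hi
      rw [← h.agree i v hi] at this
      exact mem_active.2 this
  | succ r ih =>
    obtain ⟨hrun, hT⟩ := ih (by omega) (h.anti (Nat.le_succ r))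
    have hidle : ∀ v, (∀ i, v ∉ A.touched s₀ t (c i) r) → v ∉ A.touched s₀ t z r := by
      intro v hv hz
      obtain ⟨i, hi⟩ := (hT v).1 hz
      exact hv i hi
    constructor
    · intro i v hv
      have hz := h.agree i v hv
      have hstate : A.run s₀ z r v = A.run s₀ (c i) r v := by
        by_cases hvr : v ∈ A.touched s₀ t (c i) r
        · exact hrun i v hvr
        · have hvz : v ∉ A.touched s₀ t z r := hidle v fun j hj =>
            hvr (h.disjoint i j v hv (touched_subset_succ _ _ hj) ▸ hj)
          rw [run_of_notMem_touched (by omega) hvr, run_of_notMem_touched (by omega) hvz, hz]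
      simp only [run, hstate]
      congr 1
      funext p
      -- A message to `v` from a part `j ≠ i` would put `v` into part `j` after this round. This is
      -- why disjointness is required at `r + 1` and not only at `r`.
      have key : ∀ (w : Fin n) (hw : v ≠ w), A.send (A.run s₀ z r w) (z.port w v hw) =
          A.send (A.run s₀ (c i) r w) ((c i).port w v hw) := by
        intro w hw
        by_cases hwi : w ∈ A.touched s₀ t (c i) r
        · rw [hrun i w hwi]
          simp only [Config.port, h.agree i w (touched_subset_succ _ _ hwi)]
        rw [send_of_notMem_touched (by omega) hwi]
        by_cases hwj : ∃ j, w ∈ A.touched s₀ t (c j) r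
        · obtain ⟨j, hj⟩ := hwj
          by_contra hne
          have hsome := Option.isSome_iff_ne_none.2 hne
          rw [hrun j w hj] at hsome
          simp only [Config.port, h.agree j w (touched_subset_succ _ _ hj)] at hsome
          have hvj : v ∈ A.touched s₀ t (c j) (r + 1) :=
            Finset.mem_union_right _ (mem_targets.2 ⟨w, hj, _, hsome, by simp⟩)
          have := h.disjoint i j v hv hvj
          exact hwi (this ▸ hj)
        · push Not at hwj
          exact send_of_notMem_touched (by omega) (hidle w hwj) _
      rw [key]
      have h2 : ((z v).2 p : Fin n) = (c i v).2 p := by rw [hz]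
      rw [Config.port_congr (c i) h2 rfl _ ((c i v).2 p).2.symm, h2]
    · intro w
      simp only [touched, Finset.mem_union, mem_targets]
      constructor
      · rintro (hw | ⟨v, hv, p, hp, rfl⟩)
        · obtain ⟨i, hi⟩ := (hT w).1 hw
          exact ⟨i, Or.inl hi⟩
        · obtain ⟨i, hi⟩ := (hT v).1 hv
          refine ⟨i, Or.inr ⟨v, hi, p, ?_, ?_⟩⟩
          · rwa [← hrun i v hi]
          · rw [h.agree i v (touched_subset_succ _ _ hi)]
      · rintro ⟨i, hw | ⟨v, hi, p, hp, rfl⟩⟩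
        · exact Or.inl ((hT w).2 ⟨i, hw⟩)
        · refine Or.inr ⟨v, (hT v).2 ⟨i, hi⟩, p, ?_, ?_⟩
          · rwa [hrun i v hi]
          · rw [h.agree i v (touched_subset_succ _ _ hi)]

theorem run_eq {r : ℕ} (hr : r ≤ t) (h : Glued A s₀ t c z r) {i : ι} {v : Fin n}
    (hv : v ∈ A.touched s₀ t (c i) r) : A.run s₀ z r v = A.run s₀ (c i) r v :=
  (h.run_eq_and_touched_eq hr).1 i v hv

theorem mem_touched_iff {r : ℕ} (hr : r ≤ t) (h : Glued A s₀ t c z r) {v : Fin n} :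
    v ∈ A.touched s₀ t z r ↔ ∃ i, v ∈ A.touched s₀ t (c i) r :=
  (h.run_eq_and_touched_eq hr).2 v

theorem sum_sentBy [Fintype ι] {r : ℕ} (hr : r < t) (h : Glued A s₀ t c z r) :
    ∑ v, A.sentBy s₀ z r v = ∑ i, ∑ v, A.sentBy s₀ (c i) r v := by
  rw [Finset.sum_comm]
  refine Finset.sum_congr rfl fun v _ => ?_
  by_cases hv : ∃ i, v ∈ A.touched s₀ t (c i) r
  · obtain ⟨i, hi⟩ := hv
    rw [Finset.sum_eq_single i]
    · simp only [sentBy, h.run_eq hr.le hi]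
    · intro j _ hj
      exact sentBy_of_notMem_touched hr fun hvj => hj (h.disjoint j i v hvj hi)
    · simp
  · rw [sentBy_of_notMem_touched hr (fun hz => hv ((h.mem_touched_iff hr.le).1 hz))]
    push Not at hv
    exact (Finset.sum_eq_zero fun i _ => sentBy_of_notMem_touched hr (hv i)).symm

/-- Messages of round `r` depend on the states before it, so gluing up to `r` controls the count up
to `r + 1`. This extra round makes it possible to detect when the budget is exceeded. -/
theorem sent_eq [Fintype ι] {r : ℕ} (h : Glued A s₀ t c z r) {k : ℕ} (hk : k ≤ r + 1)
    (hkt : k ≤ t) : A.sent s₀ z k = ∑ i, A.sent s₀ (c i) k := by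
  simp only [sent]
  rw [Finset.sum_comm (s := Finset.univ)]
  refine Finset.sum_congr rfl fun j hj => ?_
  have := Finset.mem_range.1 hj
  exact (h.anti (by omega : j ≤ r)).sum_sentBy (by omega)

end Glued

/-! ### Cheap elections have few active nodes -/

/-- At time `t` exactly one node is elected, all others are non-elected, and at most `m` messages
have been sent. -/
def ElectsCheaply (A : Algorithm n I) (s₀ : S → A.State) (t m : ℕ) (x : Config n S) : Prop :=
  (∃ v, A.status (A.run s₀ x t v) = Status.elected ∧
    ∀ w, w ≠ v → A.status (A.run s₀ x t w) = Status.nonElected) ∧ A.sent s₀ x t ≤ m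

theorem ElectsCheaply.card_active_le {m : ℕ} {x : Config n S} (h : ElectsCheaply A s₀ t m x) :
    (A.active s₀ t x).card ≤ 2 * m + 1 := by
  classical
  obtain ⟨⟨v₀, -, hv₀⟩, hm⟩ := h
  have hinbox : ∀ r, ∀ v, (∀ k < r, v ∉ A.targets s₀ x k Finset.univ) →
      A.run s₀ x r v = A.idle s₀ (x v).1 r := by
    intro r
    induction r with
    | zero => intro v _; rfl
    | succ r ih =>
      intro v hv
      simp only [run, idle, ih v fun k hk => hv k (by omega)]
      congr 1
      funext p
      by_contra hne
      refine hv r (by omega) (mem_targets.2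
        ⟨_, Finset.mem_univ _, _, Option.isSome_iff_ne_none.2 hne, ?_⟩)
      simp [Config.port]
  -- A node that neither receives nor sends and is not the leader `v₀` is quiet. Receivers and
  -- senders number at most `m` each, which gives `2 * m + 1`.
  have hsub : A.active s₀ t x ⊆
      (((Finset.range t).biUnion fun k => A.targets s₀ x k Finset.univ) ∪
        (Finset.range t).biUnion fun k => Finset.univ.filter fun v => A.sentBy s₀ x k v ≠ 0) ∪
        {v₀} := by
    intro v hv
    by_contra hne
    simp only [Finset.mem_union, Finset.mem_biUnion, Finset.mem_range, Finset.mem_filter,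
      Finset.mem_univ, true_and, Finset.mem_singleton, not_or, not_exists, not_and, not_not] at hne
    obtain ⟨⟨h1, h2⟩, h3⟩ := hne
    have hid : ∀ r ≤ t, A.run s₀ x r v = A.idle s₀ (x v).1 r := fun r hr =>
      hinbox r v fun k hk => h1 k (by omega)
    refine mem_active.1 hv ⟨fun r hr p => ?_, ?_⟩
    · have := h2 r hr
      rw [sentBy, Finset.card_eq_zero, Finset.filter_eq_empty_iff] at this
      have := this (Finset.mem_univ p)
      rw [← hid r hr.le]
      simpa using this
    · rw [← hid t le_rfl]
      exact hv₀ v h3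
  have hA : ((Finset.range t).biUnion fun k => A.targets s₀ x k Finset.univ).card ≤ m :=
    (Finset.card_biUnion_le.trans (Finset.sum_le_sum fun k _ => card_targets_le x k _)).trans hm
  have hB : ((Finset.range t).biUnion fun k =>
      Finset.univ.filter fun v => A.sentBy s₀ x k v ≠ 0).card ≤ m := by
    refine (Finset.card_biUnion_le.trans (Finset.sum_le_sum fun k _ => ?_)).trans hm
    rw [Finset.card_filter]
    exact Finset.sum_le_sum fun v _ => by split_ifs <;> omega
  have := Finset.card_le_card hsub
  have := Finset.card_union_le (((Finset.range t).biUnion fun k =>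
    A.targets s₀ x k Finset.univ) ∪ (Finset.range t).biUnion fun k =>
      Finset.univ.filter fun v => A.sentBy s₀ x k v ≠ 0) {v₀}
  have := Finset.card_union_le ((Finset.range t).biUnion fun k =>
    A.targets s₀ x k Finset.univ) ((Finset.range t).biUnion fun k =>
      Finset.univ.filter fun v => A.sentBy s₀ x k v ≠ 0)
  simp only [Finset.card_singleton] at *
  omega

end Algorithm

/-! ### Invariance under renaming of nodes -/

/-- Renaming the nodes of a configuration. -/
def Config.relabel {n : ℕ} {S : Type} (σ : Equiv.Perm (Fin n)) (x : Config n S) : Config n S :=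
  fun v => ((x (σ.symm v)).1, (x (σ.symm v)).2.trans
    (σ.subtypeEquiv fun w => by rw [Ne, Ne, Equiv.eq_symm_apply]))

namespace Config

variable {n : ℕ} {S : Type}

theorem port_relabel (σ : Equiv.Perm (Fin n)) (x : Config n S) (v w : Fin n) (h : w ≠ v) :
    (x.relabel σ).port v w h = x.port (σ.symm v) (σ.symm w) (σ.symm.injective.ne h) := by
  simp [port, relabel, Equiv.subtypeEquiv]

theorem relabel_symm_relabel (σ : Equiv.Perm (Fin n)) (x : Config n S) :
    (x.relabel σ).relabel σ.symm = x := by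
  funext v
  have hv : σ.symm (σ v) = v := σ.symm_apply_apply v
  refine Prod.ext ?_ ?_
  · change (x (σ.symm (σ v))).1 = _
    rw [hv]
  · ext p
    simp [relabel, Equiv.subtypeEquiv, x.apply_congr hv]

theorem relabel_injective (σ : Equiv.Perm (Fin n)) :
    Function.Injective (relabel σ : Config n S → Config n S) :=
  Function.LeftInverse.injective (relabel_symm_relabel σ)

end Config

namespace Algorithm

variable {n : ℕ} {I S : Type} {A : Algorithm n I} {s₀ : S → A.State} {t : ℕ}

theorem run_relabel (σ : Equiv.Perm (Fin n)) (x : Config n S) (r : ℕ) (v : Fin n) :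
    A.run s₀ (x.relabel σ) r v = A.run s₀ x r (σ.symm v) := by
  induction r generalizing v with
  | zero => rfl
  | succ r ih =>
    simp only [run, ih, Config.port_relabel]
    congr 1
    funext p
    have h : σ.symm ((x.relabel σ v).2 p : Fin n) = (x (σ.symm v)).2 p := by
      simp [Config.relabel, Equiv.subtypeEquiv]
    rw [Config.port_congr x h rfl _ ((x (σ.symm v)).2 p).2.symm, h]

theorem sent_relabel (σ : Equiv.Perm (Fin n)) (x : Config n S) (r : ℕ) :
    A.sent s₀ (x.relabel σ) r = A.sent s₀ x r := by
  refine Finset.sum_congr rfl fun k _ => ?_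
  simp only [sentBy, run_relabel]
  exact Equiv.sum_comp σ.symm fun v => A.sentBy s₀ x k v

theorem mem_touched_relabel (σ : Equiv.Perm (Fin n)) (x : Config n S) (r : ℕ) (v : Fin n) :
    v ∈ A.touched s₀ t (x.relabel σ) r ↔ σ.symm v ∈ A.touched s₀ t x r := by
  induction r generalizing v with
  | zero => simp [touched, mem_active, Config.relabel]
  | succ r ih =>
    simp only [touched, Finset.mem_union, mem_targets, ih, run_relabel]
    refine or_congr Iff.rfl ⟨?_, ?_⟩
    · rintro ⟨w, hw, p, hp, rfl⟩
      exact ⟨_, hw, p, hp, by simp [Config.relabel, Equiv.subtypeEquiv]⟩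
    · rintro ⟨w, hw, p, hp, h⟩
      have hs : σ.symm (σ w) = w := σ.symm_apply_apply w
      refine ⟨σ w, by rwa [hs], p, by rwa [hs], ?_⟩
      simp [Config.relabel, Equiv.subtypeEquiv, x.apply_congr hs, h]

theorem card_touched_relabel (σ : Equiv.Perm (Fin n)) (x : Config n S) (r : ℕ) :
    (A.touched s₀ t (x.relabel σ) r).card = (A.touched s₀ t x r).card := by
  refine Finset.card_bij (fun v _ => σ.symm v) (fun v hv => (mem_touched_relabel σ x r v).1 hv)
    (fun v _ w _ h => σ.symm.injective h) fun w hw => ⟨σ w, ?_, by simp⟩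
  rw [mem_touched_relabel]
  simpa using hw

end Algorithm

/-! ### Families of rows, their overlays and clouds -/

namespace Algorithm

theorem Glued.targets_eq {n : ℕ} {I S ι : Type} {A : Algorithm n I} {s₀ : S → A.State} {t r : ℕ}
    {c : ι → Config n S} {z : Config n S} (hr : r ≤ t) (h : Glued A s₀ t c z r) (i : ι) :
    A.targets s₀ z r (A.touched s₀ t (c i) r) =
      A.targets s₀ (c i) r (A.touched s₀ t (c i) r) := by
  ext w
  simp only [mem_targets]
  refine exists_congr fun v => and_congr_right fun hv => ?_
  rw [h.run_eq hr hv, h.agree i v hv]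

variable {n : ℕ} {I S : Type} (A : Algorithm n I) (s₀ : S → A.State) (t m : ℕ)

open Classical in
/-- The configuration that keeps the active nodes on the diagonal of a family and takes all other
nodes from the quiet configuration. -/
noncomputable def overlay (C : Option (Fin n) → Config n S) : Config n S :=
  fun v => if A.Quiet s₀ t (C (some v) v).1 then C none v else C (some v) v

/-- The number of rounds, at most `t`, before the runs of a family send more than `m` messages. -/
noncomputable def horizon (C : Option (Fin n) → Config n S) : ℕ :=
  Nat.findGreatest (fun r => ∑ i, A.sent s₀ (C (some i)) r ≤ m) t

/-- The nodes touched by the run of the configuration of `i`, up to the horizon. -/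
noncomputable def cloud (C : Option (Fin n) → Config n S) (i : Fin n) : Finset (Fin n) :=
  A.touched s₀ t (C (some i)) (A.horizon s₀ t m C)

variable {A s₀ t m}

theorem self_mem_cloud {C : Option (Fin n) → Config n S} {i : Fin n}
    (h : ¬ A.Quiet s₀ t (C (some i) i).1) : i ∈ A.cloud s₀ t m C i :=
  active_subset_touched _ _ (mem_active.2 h)

theorem horizon_le (C : Option (Fin n) → Config n S) : A.horizon s₀ t m C ≤ t :=
  Nat.findGreatest_le t

theorem sum_sent_horizon (C : Option (Fin n) → Config n S) :
    ∑ i, A.sent s₀ (C (some i)) (A.horizon s₀ t m C) ≤ m :=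
  Nat.findGreatest_spec (P := fun r => ∑ i, A.sent s₀ (C (some i)) r ≤ m) (Nat.zero_le t)
    (by simp [sent])

/-- The message count of `z` equals the total of the rows through round `horizon + 1`, so both
exceed the budget in the same round. The horizon can thus be read off from `z` alone. -/
theorem horizon_eq_of_glued {C : Option (Fin n) → Config n S} {z : Config n S}
    (h : Glued A s₀ t (fun i => C (some i)) z (A.horizon s₀ t m C)) :
    A.horizon s₀ t m C = Nat.findGreatest (fun r => A.sent s₀ z r ≤ m) t := by
  symm
  rw [Nat.findGreatest_eq_iff]
  refine ⟨horizon_le C, fun _ => ?_, fun r hr hrt hm => ?_⟩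
  · rw [h.sent_eq (Nat.le_succ _) (horizon_le C)]
    exact sum_sent_horizon C
  · have h1 : A.sent s₀ z (A.horizon s₀ t m C + 1) ≤ m := (sent_mono z hr).trans hm
    rw [h.sent_eq le_rfl (by omega)] at h1
    exact Nat.findGreatest_is_greatest (P := fun r => ∑ i, A.sent s₀ (C (some i)) r ≤ m) (n := t)
      (Nat.lt_succ_self (A.horizon s₀ t m C)) (by omega) h1

/-- A glued configuration that elects a leader has exactly one cloud with an elected node. -/
theorem existsUnique_elected_of_glued {C : Option (Fin n) → Config n S} {z : Config n S}
    (hg : Glued A s₀ t (fun i => C (some i)) z (A.horizon s₀ t m C))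
    (hz : ElectsCheaply A s₀ t m z) :
    ∃ i, (∃ v ∈ A.touched s₀ t (C (some i)) t,
        A.status (A.run s₀ (C (some i)) t v) = Status.elected) ∧
      ∀ j, j ≠ i → ¬ ∃ v ∈ A.touched s₀ t (C (some j)) t,
        A.status (A.run s₀ (C (some j)) t v) = Status.elected := by
  obtain ⟨⟨v, hv, hother⟩, hm⟩ := hz
  -- A cheap run stays within the budget until `t`, so the gluing covers all of it.
  have hhor : A.horizon s₀ t m C = t := by
    rw [horizon_eq_of_glued hg, Nat.findGreatest_eq_iff]
    exact ⟨le_rfl, fun _ => hm, fun r h1 h2 => by omega⟩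
  rw [hhor] at hg
  -- Untouched nodes end non-elected, hence the leader lies in some part.
  have hvT : v ∈ A.touched s₀ t z t := by
    by_contra hvT
    rw [status_of_notMem_touched hvT] at hv
    cases hv
  obtain ⟨i, hi⟩ := (hg.mem_touched_iff le_rfl).1 hvT
  refine ⟨i, ⟨v, hi, by rw [← hg.run_eq le_rfl hi]; exact hv⟩, ?_⟩
  rintro j hj ⟨w, hw, hwe⟩
  have hwv : w ≠ v := by
    rintro rfl
    exact hj (hg.disjoint j i w hw hi)
  have := hother w hwv
  rw [hg.run_eq (i := j) le_rfl hw, hwe] at this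
  cases this

open Classical in
/-- A node other than `v` whose set in the given family contains `v`. -/
noncomputable def owner (T : Fin n → Finset (Fin n)) (v : Fin n) : Option (Fin n) :=
  if h : ∃ i, i ≠ v ∧ v ∈ T i then some h.choose else none

/-- For every node `v` with an owner, exchange what the owner's configuration and the quiet
configuration prescribe at `v`. -/
noncomputable def shuffle (T : Fin n → Finset (Fin n)) (C : Option (Fin n) → Config n S) :
    Option (Fin n) → Config n S :=
  fun k v => C (Equiv.swap none (owner T v) k) v

theorem owner_ne (T : Fin n → Finset (Fin n)) (v : Fin n) : owner T v ≠ some v := by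
  unfold owner
  split_ifs with h
  · simpa using h.choose_spec.1
  · simp

/-- For a fixed `T` shuffling is an involution, so injectivity with `T` the clouds only needs the
clouds to be recoverable. -/
theorem shuffle_shuffle (T : Fin n → Finset (Fin n)) (C : Option (Fin n) → Config n S) :
    shuffle T (shuffle T C) = C := by
  funext k v
  simp [shuffle]

theorem shuffle_diag (T : Fin n → Finset (Fin n)) (C : Option (Fin n) → Config n S) (v : Fin n) :
    shuffle T C (some v) v = C (some v) v := by
  rw [shuffle, Equiv.swap_apply_of_ne_of_ne (by simp) (owner_ne T v).symm]

theorem overlay_shuffle (T : Fin n → Finset (Fin n)) (C : Option (Fin n) → Config n S)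
    (v : Fin n) : A.overlay s₀ t (shuffle T C) v =
      open Classical in if A.Quiet s₀ t (C (some v) v).1 then shuffle T C none v
        else C (some v) v := by
  rw [overlay, shuffle_diag]

/-- Rename the nodes in one configuration of a family. -/
noncomputable def relabelRow (i : Fin n) (σ : Equiv.Perm (Fin n))
    (C : Option (Fin n) → Config n S) : Option (Fin n) → Config n S :=
  Function.update C (some i) ((C (some i)).relabel σ)

theorem relabelRow_self (i : Fin n) (σ : Equiv.Perm (Fin n)) (C : Option (Fin n) → Config n S) :
    relabelRow i σ C (some i) = (C (some i)).relabel σ := by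
  simp [relabelRow]

theorem relabelRow_of_ne {i : Fin n} {k : Option (Fin n)} (h : k ≠ some i)
    (σ : Equiv.Perm (Fin n)) (C : Option (Fin n) → Config n S) :
    relabelRow i σ C k = C k := by
  simp [relabelRow, h]

theorem relabelRow_injective (i : Fin n) (σ : Equiv.Perm (Fin n)) :
    Function.Injective (relabelRow i σ : (Option (Fin n) → Config n S) → _) := by
  intro C D h
  funext k
  have hk := congrFun h k
  by_cases hki : k = some i
  · subst hki
    rw [relabelRow_self, relabelRow_self] at hk
    exact Config.relabel_injective σ hk
  · rwa [relabelRow_of_ne hki, relabelRow_of_ne hki] at hk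

theorem sent_relabelRow (i : Fin n) (σ : Equiv.Perm (Fin n)) (C : Option (Fin n) → Config n S)
    (j : Fin n) (r : ℕ) :
    A.sent s₀ (relabelRow i σ C (some j)) r = A.sent s₀ (C (some j)) r := by
  by_cases hj : j = i
  · subst hj
    rw [relabelRow_self, sent_relabel]
  · rw [relabelRow_of_ne (by simpa using hj)]

theorem horizon_relabelRow (i : Fin n) (σ : Equiv.Perm (Fin n))
    (C : Option (Fin n) → Config n S) :
    A.horizon s₀ t m (relabelRow i σ C) = A.horizon s₀ t m C := by
  simp only [horizon, sent_relabelRow]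

theorem cloud_relabelRow_of_ne {i j : Fin n} (h : j ≠ i) (σ : Equiv.Perm (Fin n))
    (C : Option (Fin n) → Config n S) :
    A.cloud s₀ t m (relabelRow i σ C) j = A.cloud s₀ t m C j := by
  rw [cloud, cloud, horizon_relabelRow, relabelRow_of_ne (by simpa using h)]

theorem mem_cloud_relabelRow (i : Fin n) (σ : Equiv.Perm (Fin n))
    (C : Option (Fin n) → Config n S) (v : Fin n) :
    v ∈ A.cloud s₀ t m (relabelRow i σ C) i ↔ σ.symm v ∈ A.cloud s₀ t m C i := by
  rw [cloud, cloud, horizon_relabelRow, relabelRow_self, mem_touched_relabel]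

theorem card_cloud_relabelRow (i : Fin n) (σ : Equiv.Perm (Fin n))
    (C : Option (Fin n) → Config n S) (j : Fin n) :
    (A.cloud s₀ t m (relabelRow i σ C) j).card = (A.cloud s₀ t m C j).card := by
  by_cases hj : j = i
  · subst hj
    rw [cloud, cloud, horizon_relabelRow, relabelRow_self, card_touched_relabel]
  · rw [cloud_relabelRow_of_ne hj]

variable [Fintype S]

variable (A s₀ t) in
open Classical in
/-- The configurations in which all nodes are quiet, except possibly `i` if `k = some i`. -/
noncomputable def rows (k : Option (Fin n)) : Finset (Config n S) :=
  Finset.univ.filter fun x => ∀ v, k ≠ some v → A.Quiet s₀ t (x v).1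

variable (A s₀ t) in
/-- Independent choices of one configuration for every node, in which at most this node is active,
and of one more configuration without active nodes. -/
noncomputable def family : Finset (Option (Fin n) → Config n S) :=
  Fintype.piFinset (A.rows s₀ t)

theorem mem_rows {k : Option (Fin n)} {x : Config n S} :
    x ∈ A.rows s₀ t k ↔ ∀ v, k ≠ some v → A.Quiet s₀ t (x v).1 := by
  simp [rows]

theorem mem_family {C : Option (Fin n) → Config n S} :
    C ∈ A.family s₀ t ↔ ∀ k v, k ≠ some v → A.Quiet s₀ t (C k v).1 := by
  simp [family, mem_rows]

theorem active_of_mem_family {C : Option (Fin n) → Config n S} (hC : C ∈ A.family s₀ t)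
    {i v : Fin n} : v ∈ A.active s₀ t (C (some i)) ↔ v = i ∧ ¬ A.Quiet s₀ t (C (some i) i).1 := by
  rw [mem_active]
  constructor
  · intro h
    have : v = i := by
      by_contra hne
      exact h (mem_family.1 hC _ _ (by simpa using Ne.symm hne))
    subst this
    exact ⟨rfl, h⟩
  · rintro ⟨rfl, h⟩
    exact h

theorem not_quiet_of_mem_cloud {C : Option (Fin n) → Config n S} (hC : C ∈ A.family s₀ t)
    {i v : Fin n} (hv : v ∈ A.cloud s₀ t m C i) : ¬ A.Quiet s₀ t (C (some i) i).1 := by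
  intro hq
  have : ∀ w, A.Quiet s₀ t (C (some i) w).1 := by
    intro w
    by_cases hw : w = i
    · rwa [hw]
    · exact mem_family.1 hC _ _ (by simpa using Ne.symm hw)
  rw [cloud, touched_eq_empty this] at hv
  simp at hv

section Shuffle

theorem shuffle_mem_family (T : Fin n → Finset (Fin n)) {C : Option (Fin n) → Config n S}
    (hC : C ∈ A.family s₀ t) : shuffle T C ∈ A.family s₀ t := by
  rw [mem_family] at hC ⊢
  intro k v hk
  refine hC _ _ fun h => hk ?_
  have := Equiv.swap_apply_of_ne_of_ne (a := none) (b := owner T v) (x := some v) (by simp)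
    (owner_ne T v).symm
  exact (Equiv.swap none (owner T v)).injective (h.trans this.symm)

/-- The centre of a cloud enters through the diagonal. Any other cloud node is quiet on the
diagonal, so the overlay looks at row `none`, where shuffling has put the owner's entry. -/
theorem glued_overlay_shuffle {C : Option (Fin n) → Config n S} (hC : C ∈ A.family s₀ t)
    (hd : ∀ i j v, v ∈ A.cloud s₀ t m C i → v ∈ A.cloud s₀ t m C j → i = j) :
    Glued A s₀ t (fun i => C (some i)) (A.overlay s₀ t (shuffle (A.cloud s₀ t m C) C))
      (A.horizon s₀ t m C) where
  disjoint := hd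
  agree i v hv := by
    change v ∈ A.cloud s₀ t m C i at hv
    rw [overlay_shuffle]
    by_cases hiv : i = v
    · subst hiv
      rw [if_neg (not_quiet_of_mem_cloud hC hv)]
    · rw [if_pos (by_contra fun h => hiv (hd i v v hv (self_mem_cloud h)))]
      have hex : ∃ i, i ≠ v ∧ v ∈ A.cloud s₀ t m C i := ⟨i, hiv, hv⟩
      -- Disjointness makes the chosen owner the only possible one.
      have hown : owner (A.cloud s₀ t m C) v = some i := by
        rw [owner, dif_pos hex]
        exact congrArg some (hd _ _ v hex.choose_spec.2 hv)
      simp [shuffle, hown]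
  quiet v hv := by
    have hq : A.Quiet s₀ t (C (some v) v).1 := by_contra fun h => hv v (self_mem_cloud h)
    have hown : owner (A.cloud s₀ t m C) v = none := by
      rw [owner, dif_neg]
      rintro ⟨i, -, hi⟩
      exact hv i hi
    rw [overlay_shuffle, if_pos hq]
    simpa [shuffle, hown] using mem_family.1 hC none v (by simp)

/-- Both families are glued into the same `z`, which fixes the horizon. The clouds are regrown round
by round: initially they are read from the diagonal, which shuffling leaves alone, and afterwards
their targets are those in `z`. -/
theorem cloud_eq_of_shuffle_eq {C C' : Option (Fin n) → Config n S} (hC : C ∈ A.family s₀ t)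
    (hC' : C' ∈ A.family s₀ t)
    (hd : ∀ i j v, v ∈ A.cloud s₀ t m C i → v ∈ A.cloud s₀ t m C j → i = j)
    (hd' : ∀ i j v, v ∈ A.cloud s₀ t m C' i → v ∈ A.cloud s₀ t m C' j → i = j)
    (h : shuffle (A.cloud s₀ t m C) C = shuffle (A.cloud s₀ t m C') C') :
    A.cloud s₀ t m C = A.cloud s₀ t m C' := by
  have hg := glued_overlay_shuffle hC hd
  have hg' := glued_overlay_shuffle hC' hd'
  rw [← h] at hg'
  set z := A.overlay s₀ t (shuffle (A.cloud s₀ t m C) C) with hz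
  have hhor : A.horizon s₀ t m C = A.horizon s₀ t m C' := by
    rw [horizon_eq_of_glued hg, horizon_eq_of_glued hg']
  have hrec : ∀ r ≤ A.horizon s₀ t m C, ∀ i,
      A.touched s₀ t (C (some i)) r = A.touched s₀ t (C' (some i)) r := by
    intro r
    induction r with
    | zero =>
      intro _ i
      ext v
      change v ∈ A.active s₀ t _ ↔ v ∈ A.active s₀ t _
      rw [active_of_mem_family hC, active_of_mem_family hC',
        ← shuffle_diag (A.cloud s₀ t m C) C i, h, shuffle_diag]
    | succ r ih =>
      intro hr i
      have hrt : r ≤ t := ((Nat.le_succ r).trans hr).trans (horizon_le C)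
      have h1 := (hg.anti ((Nat.le_succ r).trans hr)).targets_eq hrt i
      have h2 := (hg'.anti ((Nat.le_succ r).trans (hr.trans hhor.le))).targets_eq hrt i
      simp only [touched]
      rw [← h1, ← h2, ih (by omega) i]
  funext i
  rw [cloud, cloud, ← hhor]
  exact hrec _ le_rfl i

end Shuffle

/-! ### The overlay of a random family is uniform -/

section Fibres

open Classical in
-- At each `v`, exactly one of the `n + 1` entries is forced to be `z v`, and the other `n` are
-- arbitrary quiet ones. The count is the same whether `z v` is quiet or not.
theorem card_overlay_fibre (z : Config n S) :
    ((A.family s₀ t).filter fun C => A.overlay s₀ t C = z).card =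
      ∏ v : Fin n, ((Finset.univ.filter fun s : S => A.Quiet s₀ t s) ×ˢ
        (Finset.univ : Finset (Fin (n - 1) ≃ {w : Fin n // w ≠ v}))).card ^ n := by
  let q : ∀ v : Fin n, Finset (S × (Fin (n - 1) ≃ {w : Fin n // w ≠ v})) := fun v =>
    (Finset.univ.filter fun s : S => A.Quiet s₀ t s) ×ˢ Finset.univ
  -- The row whose entry at `v` is forced: `none` if `z v` is quiet, the diagonal otherwise.
  let pos : Fin n → Option (Fin n) := fun v => if A.Quiet s₀ t (z v).1 then none else some v
  let col : ∀ v : Fin n, Finset (Option (Fin n) → S × (Fin (n - 1) ≃ {w : Fin n // w ≠ v})) :=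
    fun v => Fintype.piFinset fun k => if k = pos v then {z v} else q v
  have hcol : ∀ v, (col v).card = (q v).card ^ n := by
    intro v
    rw [Fintype.card_piFinset, ← Finset.mul_prod_erase _ _ (Finset.mem_univ (pos v))]
    rw [if_pos rfl, Finset.card_singleton, one_mul,
      Finset.prod_congr rfl fun k hk => by rw [if_neg (Finset.ne_of_mem_erase hk)],
      Finset.prod_const, Finset.card_erase_of_mem (Finset.mem_univ _)]
    simp
  change _ = ∏ v, (q v).card ^ n
  rw [← Finset.prod_congr rfl fun v _ => hcol v, ← Fintype.card_piFinset]
  have hq : ∀ v a, a ∈ q v ↔ A.Quiet s₀ t a.1 := by intro v a; simp [q]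
  refine Finset.card_nbij' (fun C v k => C k v) (fun D k v => D v k) ?_ ?_ (fun _ _ => rfl)
    (fun _ _ => rfl)
  · intro C hC
    simp only [Finset.coe_filter, Set.mem_ofPred_eq, mem_family] at hC
    obtain ⟨hC, rfl⟩ := hC
    simp only [Finset.mem_coe, Fintype.mem_piFinset, col]
    intro v k
    by_cases hd : A.Quiet s₀ t (C (some v) v).1
    · have hz : A.overlay s₀ t C v = C none v := if_pos hd
      have hpos : pos v = none := by
        simp only [pos, hz]
        exact if_pos (hC none v (by simp))
      rw [hpos, hz]
      split_ifs with hk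
      · simp [hk]
      · rw [hq]
        by_cases hkv : k = some v
        · rwa [hkv]
        · exact hC k v hkv
    · have hz : A.overlay s₀ t C v = C (some v) v := if_neg hd
      have hpos : pos v = some v := by
        simp only [pos, hz]
        exact if_neg hd
      rw [hpos, hz]
      split_ifs with hk
      · simp [hk]
      · rw [hq]
        exact hC k v hk
  · intro D hD
    simp only [Finset.mem_coe, Fintype.mem_piFinset, col] at hD
    simp only [Finset.coe_filter, Set.mem_ofPred_eq, mem_family]
    constructor
    · intro k v hk
      have := hD v k
      split_ifs at this with h
      · rw [Finset.mem_singleton] at this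
        rw [this]
        by_contra hz
        exact hk (by rw [h]; exact if_neg hz)
      · exact (hq _ _).1 this
    · funext v
      by_cases hz : A.Quiet s₀ t (z v).1
      · have hpos : pos v = none := if_pos hz
        have h1 := hD v none
        have h2 := hD v (some v)
        rw [if_pos hpos.symm, Finset.mem_singleton] at h1
        rw [if_neg (by rw [hpos]; simp), hq] at h2
        simp only [overlay, if_pos h2, h1]
      · have hpos : pos v = some v := if_neg hz
        have h2 := hD v (some v)
        rw [if_pos hpos.symm, Finset.mem_singleton] at h2
        simp only [overlay, h2, if_neg hz]

open Classical in
/-- A uniformly random family has a uniformly random overlay. -/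
theorem exists_card_overlay : ∃ κ : ℕ, ((∃ s, A.Quiet s₀ t s) → 0 < κ) ∧
    ∀ P : Config n S → Prop, ((A.family s₀ t).filter fun C => P (A.overlay s₀ t C)).card =
      κ * (Finset.univ.filter P).card := by
  refine ⟨∏ v : Fin n, ((Finset.univ.filter fun s : S => A.Quiet s₀ t s) ×ˢ
    (Finset.univ : Finset (Fin (n - 1) ≃ {w : Fin n // w ≠ v}))).card ^ n, ?_, fun P => ?_⟩
  · rintro ⟨s, hs⟩
    refine Finset.prod_pos fun v _ => pow_pos (Finset.card_pos.2 ⟨(s, ?_), ?_⟩) _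
    · exact Fintype.equivOfCardEq (by simp [Fintype.card_subtype_compl])
    · simpa using hs
  · rw [Finset.card_eq_sum_card_fiberwise (f := A.overlay s₀ t) (t := Finset.univ.filter P)]
    · rw [Finset.sum_congr rfl fun z hz => ?_, Finset.sum_const, smul_eq_mul, mul_comm]
      rw [← card_overlay_fibre z, Finset.filter_filter]
      congr 1
      refine Finset.filter_congr fun C _ => ⟨fun h => h.2, fun h => ⟨?_, h⟩⟩
      rw [h]
      simpa using hz
    · intro C hC
      simpa using (Finset.mem_filter.1 hC).2

end Fibres

/-! ### Symmetry of the rows and collisions of clouds -/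

section Relabel

theorem relabel_mem_rows {σ : Equiv.Perm (Fin n)} {i : Fin n} {x : Config n S}
    (hx : x ∈ A.rows s₀ t (some i)) : x.relabel σ ∈ A.rows s₀ t (some (σ i)) := by
  rw [mem_rows] at hx ⊢
  intro v hv
  refine hx (σ.symm v) fun h => hv ?_
  rw [Option.some_inj] at h ⊢
  rw [h, Equiv.apply_symm_apply]

open Classical in
theorem card_rows_filter_eq {P : Config n S → Prop} (hP : ∀ σ x, P x → P (Config.relabel σ x))
    (i j : Fin n) : ((A.rows s₀ t (some i)).filter P).card =
      ((A.rows s₀ t (some j)).filter P).card := by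
  have key : ∀ i j : Fin n, ((A.rows s₀ t (some i)).filter P).card ≤
      ((A.rows s₀ t (some j)).filter P).card := by
    intro i j
    refine Finset.card_le_card_of_injOn (Config.relabel (Equiv.swap i j)) ?_
      (Config.relabel_injective _).injOn
    intro x hx
    simp only [Finset.coe_filter, Set.mem_ofPred_eq] at hx ⊢
    refine ⟨?_, hP _ _ hx.2⟩
    simpa using relabel_mem_rows (σ := Equiv.swap i j) hx.1
  exact le_antisymm (key i j) (key j i)

theorem relabelRow_mem_family {i : Fin n} {σ : Equiv.Perm (Fin n)} (hσ : σ i = i)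
    {C : Option (Fin n) → Config n S} (hC : C ∈ A.family s₀ t) :
    relabelRow i σ C ∈ A.family s₀ t := by
  simp only [family, Fintype.mem_piFinset] at hC ⊢
  intro k
  by_cases hki : k = some i
  · subst hki
    rw [relabelRow_self]
    simpa [hσ] using relabel_mem_rows (σ := σ) (hC (some i))
  · rw [relabelRow_of_ne hki]
    exact hC k

end Relabel

section Collisions

variable (A s₀ t m) in
open Classical in
/-- The families with clouds of total size at most `M`. -/
noncomputable def smallFamily (M : ℕ) : Finset (Option (Fin n) → Config n S) :=
  (A.family s₀ t).filter fun C => ∑ i, (A.cloud s₀ t m C i).card ≤ M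

variable (A s₀ t m) in
open Classical in
/-- The number of small families with `a` in the cloud of `i` and `b` in the cloud of `j`. -/
noncomputable def hits (M : ℕ) (i j a b : Fin n) : ℕ :=
  ((A.smallFamily s₀ t m M).filter fun C =>
    a ∈ A.cloud s₀ t m C i ∧ b ∈ A.cloud s₀ t m C j).card

/-- Swapping the names `a` and `a'` in row `i` alone keeps `i`, all cloud sizes and the cloud of
`j`. Apart from its centre, a cloud is thus placed symmetrically, whatever the other clouds are. -/
theorem hits_le_hits {M : ℕ} {i j a a' : Fin n} (hij : i ≠ j) (ha : a ≠ i) (ha' : a' ≠ i)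
    (b : Fin n) : A.hits s₀ t m M i j a b ≤ A.hits s₀ t m M i j a' b := by
  classical
  refine Finset.card_le_card_of_injOn (relabelRow i (Equiv.swap a a')) ?_
    (relabelRow_injective _ _).injOn
  intro C hC
  simp only [smallFamily, Finset.coe_filter, Finset.mem_filter, Set.mem_ofPred_eq] at hC ⊢
  refine ⟨⟨relabelRow_mem_family (Equiv.swap_apply_of_ne_of_ne ha.symm ha'.symm) hC.1.1, ?_⟩,
    ?_, ?_⟩
  · simpa only [card_cloud_relabelRow] using hC.1.2
  · rw [mem_cloud_relabelRow]
    simpa using hC.2.1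
  · rw [cloud_relabelRow_of_ne hij.symm]
    exact hC.2.2

theorem hits_comm (M : ℕ) (i j a b : Fin n) :
    A.hits s₀ t m M i j a b = A.hits s₀ t m M j i b a := by
  simp only [hits, and_comm]

theorem mul_hits_le {M : ℕ} {i j a : Fin n} (hij : i ≠ j) (ha : a ≠ i) (b : Fin n) :
    (n - 1) * A.hits s₀ t m M i j a b ≤ ∑ a', A.hits s₀ t m M i j a' b := by
  calc (n - 1) * A.hits s₀ t m M i j a b
      = ∑ _a' ∈ Finset.univ.erase i, A.hits s₀ t m M i j a b := by
        rw [Finset.sum_const, Finset.card_erase_of_mem (Finset.mem_univ _), smul_eq_mul]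
        simp
    _ ≤ ∑ a' ∈ Finset.univ.erase i, A.hits s₀ t m M i j a' b :=
        Finset.sum_le_sum fun a' ha' => hits_le_hits hij ha (Finset.ne_of_mem_erase ha') b
    _ ≤ _ := Finset.sum_le_sum_of_subset (Finset.subset_univ _)

/-- The symmetry of row `i` is useless for `v = i`; then `v ≠ j` and row `j` is averaged instead.
Adding both bounds covers the two cases. -/
theorem mul_hits_diag_le {M : ℕ} {i j : Fin n} (hij : i ≠ j) (v : Fin n) :
    (n - 1) * A.hits s₀ t m M i j v v ≤
      ∑ a, A.hits s₀ t m M i j a v + ∑ a, A.hits s₀ t m M i j v a := by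
  by_cases hv : v = i
  · have := mul_hits_le (A := A) (s₀ := s₀) (t := t) (m := m) (M := M) hij.symm
      (hv ▸ hij : v ≠ j) v
    rw [hits_comm]
    refine this.trans (le_add_left (Finset.sum_le_sum fun a _ => ?_))
    rw [hits_comm]
  · exact (mul_hits_le hij hv v).trans (Nat.le_add_right _ _)

theorem sum_hits (M : ℕ) (i j : Fin n) :
    ∑ a, ∑ b, A.hits s₀ t m M i j a b =
      ∑ C ∈ A.smallFamily s₀ t m M, (A.cloud s₀ t m C i).card * (A.cloud s₀ t m C j).card := by
  classical
  simp only [hits, Finset.card_filter]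
  rw [Finset.sum_congr rfl fun a _ => Finset.sum_comm, Finset.sum_comm]
  refine Finset.sum_congr rfl fun C _ => ?_
  rw [← Finset.card_product, ← Finset.sum_product', ← Finset.card_filter]
  congr 1
  ext ⟨a, b⟩
  simp

open Classical in
/-- Clouds of small total size rarely meet. -/
theorem card_collisions_le (M : ℕ) :
    (n - 1) * ((A.smallFamily s₀ t m M).filter fun C => ¬ ∀ i j v,
      v ∈ A.cloud s₀ t m C i → v ∈ A.cloud s₀ t m C j → i = j).card ≤
        2 * M ^ 2 * (A.family s₀ t).card := by
  have h1 : ((A.smallFamily s₀ t m M).filter fun C => ¬ ∀ i j v,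
      v ∈ A.cloud s₀ t m C i → v ∈ A.cloud s₀ t m C j → i = j).card ≤
        ∑ i, ∑ j ∈ Finset.univ.erase i, ∑ v, A.hits s₀ t m M i j v v := by
    have : ((A.smallFamily s₀ t m M).filter fun C => ¬ ∀ i j v,
        v ∈ A.cloud s₀ t m C i → v ∈ A.cloud s₀ t m C j → i = j) ⊆
          Finset.univ.biUnion fun i => (Finset.univ.erase i).biUnion fun j =>
            Finset.univ.biUnion fun v => (A.smallFamily s₀ t m M).filter fun C =>
              v ∈ A.cloud s₀ t m C i ∧ v ∈ A.cloud s₀ t m C j := by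
      intro C hC
      rw [Finset.mem_filter] at hC
      obtain ⟨hC, hne⟩ := hC
      push Not at hne
      obtain ⟨i, j, v, hi, hj, hij⟩ := hne
      simp only [Finset.mem_biUnion, Finset.mem_univ, true_and, Finset.mem_erase, and_true,
        Finset.mem_filter]
      exact ⟨i, j, hij.symm, v, hC, hi, hj⟩
    refine (Finset.card_le_card this).trans ?_
    refine Finset.card_biUnion_le.trans (Finset.sum_le_sum fun i _ => ?_)
    refine Finset.card_biUnion_le.trans (Finset.sum_le_sum fun j _ => ?_)
    exact Finset.card_biUnion_le
  refine (Nat.mul_le_mul_left _ h1).trans ?_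
  have h2 : ∀ i, ∀ j ∈ Finset.univ.erase i, (n - 1) * ∑ v, A.hits s₀ t m M i j v v ≤
      2 * ∑ C ∈ A.smallFamily s₀ t m M,
        (A.cloud s₀ t m C i).card * (A.cloud s₀ t m C j).card := by
    intro i j hj
    rw [Finset.mul_sum, ← sum_hits]
    refine (Finset.sum_le_sum fun v _ =>
      mul_hits_diag_le (Finset.ne_of_mem_erase hj).symm v).trans ?_
    rw [Finset.sum_add_distrib, Finset.sum_comm, two_mul]
  calc (n - 1) * ∑ i, ∑ j ∈ Finset.univ.erase i, ∑ v, A.hits s₀ t m M i j v v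
      ≤ ∑ i, ∑ j ∈ Finset.univ.erase i, 2 * ∑ C ∈ A.smallFamily s₀ t m M,
        (A.cloud s₀ t m C i).card * (A.cloud s₀ t m C j).card := by
        rw [Finset.mul_sum]
        simp_rw [Finset.mul_sum _ _ (n - 1)] at h2 ⊢
        exact Finset.sum_le_sum fun i _ => Finset.sum_le_sum fun j hj => h2 i j hj
    _ ≤ ∑ i, ∑ j, 2 * ∑ C ∈ A.smallFamily s₀ t m M,
        (A.cloud s₀ t m C i).card * (A.cloud s₀ t m C j).card :=
        Finset.sum_le_sum fun i _ => Finset.sum_le_sum_of_subset (Finset.subset_univ _)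
    _ = 2 * ∑ C ∈ A.smallFamily s₀ t m M, (∑ i, (A.cloud s₀ t m C i).card) ^ 2 := by
        simp only [← Finset.mul_sum, sq, Finset.sum_mul_sum]
        congr 1
        rw [Finset.sum_congr rfl fun i _ => Finset.sum_comm, Finset.sum_comm]
        simp only [Finset.mul_sum]
    _ ≤ 2 * ∑ C ∈ A.smallFamily s₀ t m M, M ^ 2 := by
        refine Nat.mul_le_mul_left _ (Finset.sum_le_sum fun C hC => ?_)
        exact Nat.pow_le_pow_left (Finset.mem_filter.1 hC).2 2
    _ ≤ 2 * M ^ 2 * (A.family s₀ t).card := by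
        rw [Finset.sum_const, smul_eq_mul, mul_assoc, mul_comm (M ^ 2)]
        exact Nat.mul_le_mul_left _ (Nat.mul_le_mul_right _
          (Finset.card_le_card (Finset.filter_subset _ _)))

theorem active_overlay {C : Option (Fin n) → Config n S} (hC : C ∈ A.family s₀ t) :
    A.active s₀ t (A.overlay s₀ t C) =
      A.active s₀ t fun v => C (some v) v := by
  ext v
  simp only [mem_active, overlay]
  split_ifs with h
  · simp [h, mem_family.1 hC none v (by simp)]
  · rfl

/-- A row has at most one active node, on the diagonal, and up to the horizon all rows together send
at most `m` messages. -/
theorem sum_card_cloud_le {C : Option (Fin n) → Config n S} (hC : C ∈ A.family s₀ t) :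
    ∑ i, (A.cloud s₀ t m C i).card ≤ (A.active s₀ t fun v => C (some v) v).card + m := by
  classical
  have h : ∀ i, (A.active s₀ t (C (some i))).card =
      if ¬ A.Quiet s₀ t (C (some i) i).1 then 1 else 0 := by
    intro i
    by_cases hq : ¬ A.Quiet s₀ t (C (some i) i).1
    · rw [if_pos hq]
      rw [Finset.card_eq_one]
      exact ⟨i, by ext v; simp [active_of_mem_family hC, hq]⟩
    · rw [if_neg hq, Finset.card_eq_zero]
      ext v
      simpa [active_of_mem_family hC] using fun _ => not_not.1 hq
  calc ∑ i, (A.cloud s₀ t m C i).card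
      ≤ ∑ i, ((A.active s₀ t (C (some i))).card +
          A.sent s₀ (C (some i)) (A.horizon s₀ t m C)) :=
        Finset.sum_le_sum fun i _ => card_touched_le _ _
    _ ≤ _ := by
        rw [Finset.sum_add_distrib]
        refine Nat.add_le_add (le_of_eq ?_) (sum_sent_horizon C)
        rw [Finset.sum_congr rfl fun i _ => h i, active, Finset.card_filter]

end Collisions

end Algorithm

/-! ### The bound for finitely many seeds -/

theorem mul_one_sub_pow_le {n : ℕ} (hn : 2 ≤ n) {p : ℝ} (h0 : 0 ≤ p) (h1 : p ≤ 1) :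
    n * (p * (1 - p) ^ (n - 1)) ≤ n / (n - 1) * Real.exp (-1) := by
  have hn1 : (0 : ℝ) < n - 1 := by
    have : (2 : ℝ) ≤ n := by exact_mod_cast hn
    linarith
  have hpow : (1 - p) ^ (n - 1) ≤ Real.exp (-(p * (n - 1))) := by
    have := pow_le_pow_left₀ (by linarith) (Real.one_sub_le_exp_neg p) (n - 1)
    rw [← Real.exp_nat_mul, Nat.cast_sub (by omega), Nat.cast_one] at this
    rwa [show -(p * ((n : ℝ) - 1)) = (n - 1) * -p by ring]
  -- With `y = p * (n - 1)` this is `y * exp (-y) ≤ exp (-1)`, from `y ≤ exp (y - 1)`.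
  have hy : p * (n - 1) * Real.exp (-(p * (n - 1))) ≤ Real.exp (-1) := by
    have h := Real.add_one_le_exp (p * (n - 1) - 1)
    calc p * (n - 1) * Real.exp (-(p * (n - 1)))
        ≤ Real.exp (p * (n - 1) - 1) * Real.exp (-(p * (n - 1))) := by
          gcongr
          linarith
      _ = Real.exp (-1) := by rw [← Real.exp_add]; ring_nf
  calc n * (p * (1 - p) ^ (n - 1)) ≤ n * (p * Real.exp (-(p * (n - 1)))) := by gcongr
    _ = n / (n - 1) * (p * (n - 1) * Real.exp (-(p * (n - 1)))) := by field_simp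
    _ ≤ n / (n - 1) * Real.exp (-1) := by gcongr

namespace Algorithm

variable {n : ℕ} {I S : Type} [Fintype S] {A : Algorithm n I} {s₀ : S → A.State} {t m : ℕ}

open Classical in
/-- Independent and identically distributed rows rarely contain exactly one row with a given
property. -/
theorem card_exactly_one_le (hn : 2 ≤ n) {P : Config n S → Prop}
    (hP : ∀ σ x, P x → P (Config.relabel σ x)) :
    (((A.family s₀ t).filter fun C => ∃ i, P (C (some i)) ∧
      ∀ j, j ≠ i → ¬ P (C (some j))).card : ℝ) ≤
        n / (n - 1) * Real.exp (-1) * (A.family s₀ t).card := by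
  let i₀ : Fin n := ⟨0, by omega⟩
  set w := ((A.rows s₀ t (some i₀)).filter P).card with hw
  set R := (A.rows s₀ t (some i₀)).card with hR
  set R₀ := (A.rows s₀ t none).card with hR₀
  have hwi : ∀ i, ((A.rows s₀ t (some i)).filter P).card = w := fun i =>
    card_rows_filter_eq hP i i₀
  have hRi : ∀ i, (A.rows s₀ t (some i)).card = R := fun i => by
    simpa using card_rows_filter_eq (A := A) (s₀ := s₀) (t := t)
      (P := fun _ => True) (fun _ _ h => h) i i₀
  have hwR : w ≤ R := Finset.card_filter_le _ _
  have hwi' : ∀ i, ((A.rows s₀ t (some i)).filter fun x => ¬ P x).card = R - w := fun i => by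
    have := Finset.card_filter_add_card_filter_not (s := A.rows s₀ t (some i)) P
    rw [hwi, hRi] at this
    omega
  have hfam : (A.family s₀ t).card = R₀ * R ^ n := by
    rw [family, Fintype.card_piFinset, Fintype.prod_option]
    simp [hRi, hR₀]
  have hle : ((A.family s₀ t).filter fun C => ∃ i, P (C (some i)) ∧
      ∀ j, j ≠ i → ¬ P (C (some j))).card ≤ n * (R₀ * (w * (R - w) ^ (n - 1))) := by
    -- The families in which row `i` is the one with property `P` form a product of sets of rows;
    -- row `none` is unconstrained.
    let B : Fin n → Option (Fin n) → Finset (Config n S) := fun i k =>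
      (A.rows s₀ t k).filter fun x => ∀ j, k = some j → if j = i then P x else ¬ P x
    have hB0 : ∀ i, (B i none).card = R₀ := fun i => by simp [B, hR₀]
    have hB1 : ∀ i, (B i (some i)).card = w := fun i => by simp [B, hwi]
    have hB2 : ∀ i j, j ≠ i → (B i (some j)).card = R - w := fun i j hj => by
      simp [B, hwi', hj]
    have hsub : ((A.family s₀ t).filter fun C => ∃ i, P (C (some i)) ∧
        ∀ j, j ≠ i → ¬ P (C (some j))) ⊆
          Finset.univ.biUnion fun i => Fintype.piFinset (B i) := by
      intro C hC
      rw [Finset.mem_filter] at hC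
      obtain ⟨hC, i, hi, hj⟩ := hC
      refine Finset.mem_biUnion.2 ⟨i, Finset.mem_univ _, Fintype.mem_piFinset.2 fun k => ?_⟩
      refine Finset.mem_filter.2 ⟨Fintype.mem_piFinset.1 hC k, ?_⟩
      rintro j rfl
      split_ifs with h
      · rwa [h]
      · exact hj j h
    refine (Finset.card_le_card hsub).trans (Finset.card_biUnion_le.trans (le_of_eq ?_))
    rw [Finset.sum_congr rfl fun i _ => ?_, Finset.sum_const, Finset.card_univ, Fintype.card_fin,
      smul_eq_mul]
    rw [Fintype.card_piFinset, Fintype.prod_option, hB0,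
      ← Finset.mul_prod_erase _ _ (Finset.mem_univ i), hB1,
      Finset.prod_congr rfl fun j hj => hB2 i j (Finset.ne_of_mem_erase hj), Finset.prod_const,
      Finset.card_erase_of_mem (Finset.mem_univ _)]
    simp
  rcases Nat.eq_zero_or_pos R with h0 | hpos
  · have hw0 : w = 0 := by omega
    have : ((A.family s₀ t).filter fun C => ∃ i, P (C (some i)) ∧
      ∀ j, j ≠ i → ¬ P (C (some j))).card = 0 := by simpa [hw0] using hle
    rw [this, hfam, h0]
    simp [show n ≠ 0 by omega]
  have hRr : (0 : ℝ) < R := by exact_mod_cast hpos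
  have hp := mul_one_sub_pow_le hn (p := w / R) (by positivity)
    ((div_le_one hRr).2 (by exact_mod_cast hwR))
  calc _ ≤ ((n * (R₀ * (w * (R - w) ^ (n - 1))) : ℕ) : ℝ) := Nat.cast_le.2 hle
    _ = n * (w / R * (1 - w / R) ^ (n - 1)) * (R₀ * R ^ n) := by
        have : (R : ℝ) ^ n = R * R ^ (n - 1) := by
          rw [← pow_succ', Nat.sub_add_cancel (by omega)]
        rw [this, one_sub_div hRr.ne', div_pow]
        push_cast [Nat.cast_sub hwR]
        field_simp
    _ ≤ n / (n - 1) * Real.exp (-1) * (R₀ * R ^ n) :=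
        mul_le_mul_of_nonneg_right hp (by positivity)
    _ = _ := by rw [hfam]; push_cast; rfl

open Classical in
/-- With uniformly random seeds and ports, a leader is rarely elected with few messages. -/
theorem card_electsCheaply_le (hmn : 2 * m + 1 < n) :
    ((Finset.univ.filter fun x : Config n S => ElectsCheaply A s₀ t m x).card : ℝ) ≤
      (2 * (3 * m + 1) ^ 2 / (n - 1) + n / (n - 1) * Real.exp (-1)) *
        Fintype.card (Config n S) := by
  have hn1 : (0 : ℝ) < n - 1 := by
    have : (2 : ℝ) ≤ n := by exact_mod_cast (by omega : 2 ≤ n)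
    linarith
  by_cases hq : ∃ s, A.Quiet s₀ t s
  swap
  -- Without quiet seeds all `n > 2 * m + 1` nodes are active, so no election is cheap. Otherwise
  -- `κ` is positive and can be cancelled.
  · have : (Finset.univ.filter fun x : Config n S => ElectsCheaply A s₀ t m x) = ∅ := by
      rw [Finset.filter_eq_empty_iff]
      intro x _ hx
      have h1 := hx.card_active_le
      have h2 : A.active s₀ t x = Finset.univ := by
        ext v
        simpa [mem_active] using fun h => hq ⟨_, h⟩
      rw [h2, Finset.card_univ, Fintype.card_fin] at h1
      omega
    rw [this]
    simp only [Finset.card_empty, Nat.cast_zero]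
    positivity
  obtain ⟨κ, hκ, hfib⟩ := exists_card_overlay (A := A) (s₀ := s₀) (t := t)
  let few : Config n S → Prop := fun x => (A.active s₀ t x).card ≤ 2 * m + 1
  let G : Config n S → Prop := ElectsCheaply A s₀ t m
  let D : (Option (Fin n) → Config n S) → Prop := fun C =>
    ∀ i j v, v ∈ A.cloud s₀ t m C i → v ∈ A.cloud s₀ t m C j → i = j
  let Ψ : (Option (Fin n) → Config n S) → Option (Fin n) → Config n S := fun C =>
    shuffle (A.cloud s₀ t m C) C
  let F := (A.family s₀ t).filter fun C => few fun v => C (some v) v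
  have hfew : ∀ C ∈ A.family s₀ t, (few (A.overlay s₀ t C) ↔ few fun v => C (some v) v) := by
    intro C hC
    simp only [few, active_overlay hC]
  have hF : F.card = κ * (Finset.univ.filter few).card := by
    refine Eq.trans ?_ ((hfib few).trans (by congr!))
    congr 1
    ext C
    simp only [F, Finset.mem_filter]
    exact and_congr_right fun hC => (hfew C hC).symm
  -- An injection bounds the number of families from above, so it is applied to failures. Successes
  -- are then bounded as the complement within `few`.
  have hinj : (F.filter fun C => D C ∧ ¬ G (A.overlay s₀ t (Ψ C))).card ≤
      κ * (Finset.univ.filter fun x => few x ∧ ¬ G x).card := by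
    refine le_trans ?_ (le_of_eq ((hfib fun x => few x ∧ ¬ G x).trans (by congr!)))
    refine Finset.card_le_card_of_injOn Ψ ?_ ?_
    · intro C hC
      simp only [F, Finset.coe_filter, Finset.mem_filter, Set.mem_ofPred_eq] at hC ⊢
      obtain ⟨⟨hC, hf⟩, hd, hg⟩ := hC
      have hmem := shuffle_mem_family (A.cloud s₀ t m C) hC
      refine ⟨hmem, (hfew _ hmem).2 ?_, hg⟩
      simpa only [Ψ, shuffle_diag] using hf
    · intro C hC C' hC' h
      simp only [F, Finset.coe_filter, Finset.mem_filter, Set.mem_ofPred_eq] at hC hC'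
      have hT := cloud_eq_of_shuffle_eq hC.1.1 hC'.1.1 hC.2.1 hC'.2.1 h
      have := congrArg (shuffle (A.cloud s₀ t m C)) h
      simp only [Ψ] at this
      rw [shuffle_shuffle, hT, shuffle_shuffle] at this
      exact this
  have hsplit : (Finset.univ.filter few).card = (Finset.univ.filter G).card +
      (Finset.univ.filter fun x => few x ∧ ¬ G x).card := by
    rw [← Finset.card_filter_add_card_filter_not (s := Finset.univ.filter few) G,
      Finset.filter_filter, Finset.filter_filter]
    congr 2
    exact Finset.filter_congr fun x _ =>
      ⟨fun h => h.2, fun h => ⟨ElectsCheaply.card_active_le h, h⟩⟩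
  have hcover : F.card ≤ (F.filter fun C => D C ∧ ¬ G (A.overlay s₀ t (Ψ C))).card +
      ((F.filter fun C => ¬ D C).card +
        (F.filter fun C => D C ∧ G (A.overlay s₀ t (Ψ C))).card) := by
    refine le_trans (Finset.card_le_card fun C hC => ?_)
      ((Finset.card_union_le _ _).trans (Nat.add_le_add_left (Finset.card_union_le _ _) _))
    simp only [Finset.mem_union, Finset.mem_filter]
    tauto
  -- At most `2 * m + 1` active nodes and `m` messages give total cloud size at most `3 * m + 1`.
  have hcoll : (F.filter fun C => ¬ D C).card ≤
      ((A.smallFamily s₀ t m (3 * m + 1)).filter fun C => ¬ D C).card := by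
    refine Finset.card_le_card (Finset.filter_subset_filter _ fun C hC => ?_)
    obtain ⟨hC, hf⟩ := Finset.mem_filter.1 hC
    refine Finset.mem_filter.2 ⟨hC, (sum_card_cloud_le hC).trans ?_⟩
    have : (A.active s₀ t fun v => C (some v) v).card ≤ 2 * m + 1 := hf
    omega
  have hcoll' : (((A.smallFamily s₀ t m (3 * m + 1)).filter fun C => ¬ D C).card : ℝ) ≤
      2 * (3 * m + 1) ^ 2 / (n - 1) * (A.family s₀ t).card := by
    have h : (((n - 1) * ((A.smallFamily s₀ t m (3 * m + 1)).filter fun C => ¬ D C).card : ℕ) : ℝ)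
        ≤ ((2 * (3 * m + 1) ^ 2 * (A.family s₀ t).card : ℕ) : ℝ) :=
      Nat.cast_le.2 (card_collisions_le (3 * m + 1))
    push_cast [Nat.cast_sub (by omega : 1 ≤ n)] at h
    rw [div_mul_eq_mul_div, le_div_iff₀ hn1]
    linarith
  have hone : ((F.filter fun C => D C ∧ G (A.overlay s₀ t (Ψ C))).card : ℝ) ≤
      n / (n - 1) * Real.exp (-1) * (A.family s₀ t).card := by
    refine le_trans (Nat.cast_le.2 (Finset.card_le_card fun C hC => ?_))
      (card_exactly_one_le (A := A) (s₀ := s₀) (t := t) (by omega : 2 ≤ n)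
        (P := fun c => ∃ v ∈ A.touched s₀ t c t, A.status (A.run s₀ c t v) = Status.elected) ?_)
    · simp only [F, Finset.mem_filter] at hC ⊢
      exact ⟨hC.1.1, existsUnique_elected_of_glued (glued_overlay_shuffle hC.1.1 hC.2.1) hC.2.2⟩
    · rintro σ x ⟨v, hv, hs⟩
      refine ⟨σ v, ?_, ?_⟩
      · rw [mem_touched_relabel, Equiv.symm_apply_apply]
        exact hv
      · rw [run_relabel, Equiv.symm_apply_apply]
        exact hs
  have hall : (A.family s₀ t).card = κ * Fintype.card (Config n S) := by
    have := hfib fun _ => True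
    simpa using this
  have hmain : κ * (Finset.univ.filter G).card ≤ (F.filter fun C => ¬ D C).card +
      (F.filter fun C => D C ∧ G (A.overlay s₀ t (Ψ C))).card := by
    rw [hsplit, mul_add] at hF
    omega
  have hmain' : (κ : ℝ) * (Finset.univ.filter G).card ≤ (F.filter fun C => ¬ D C).card +
      (F.filter fun C => D C ∧ G (A.overlay s₀ t (Ψ C))).card := by exact_mod_cast hmain
  have hcollr : ((F.filter fun C => ¬ D C).card : ℝ) ≤
      ((A.smallFamily s₀ t m (3 * m + 1)).filter fun C => ¬ D C).card := by exact_mod_cast hcoll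
  rw [hall] at hcoll' hone
  push_cast at hcoll' hone
  have hκr : (0 : ℝ) < κ := by exact_mod_cast hκ hq
  refine le_of_mul_le_mul_left ?_ hκr
  calc (κ : ℝ) * (Finset.univ.filter G).card
      ≤ 2 * (3 * m + 1) ^ 2 / (n - 1) * (κ * Fintype.card (Config n S)) +
        n / (n - 1) * Real.exp (-1) * (κ * Fintype.card (Config n S)) := by linarith
    _ = _ := by ring

end Algorithm

/-! ### Measurability and reduction to a fixed time -/

instance (n : ℕ) : DiscreteMeasurableSpace (Ports n) := ⟨fun _ => trivial⟩

instance : IsProbabilityMeasure tapeMeasure := by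
  unfold tapeMeasure
  infer_instance

instance (n : ℕ) : IsProbabilityMeasure (runMeasure n) := by
  unfold runMeasure
  infer_instance

/-- Distinct coordinates of an independent and identically distributed vector are again
independent and identically distributed. -/
theorem measurePreserving_comp_injective {ι κ X : Type*} [Fintype ι] [Fintype κ]
    [MeasurableSpace X] (μ : Measure X) [IsProbabilityMeasure μ] {k : ι → κ}
    (hk : Function.Injective k) :
    MeasurePreserving (fun s : κ → X => s ∘ k) (Measure.pi fun _ => μ) (Measure.pi fun _ => μ) := by
  classical
  have hmeas : Measurable fun s : κ → X => s ∘ k :=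
    measurable_pi_lambda _ fun i => measurable_pi_apply (k i)
  refine ⟨hmeas, (Measure.pi_eq fun B hB => ?_).symm⟩
  rw [Measure.map_apply hmeas (MeasurableSet.univ_pi hB)]
  have hpre : (fun s : κ → X => s ∘ k) ⁻¹' Set.univ.pi B =
      Set.univ.pi (Function.extend k B fun _ => Set.univ) := by
    ext s
    simp only [Set.mem_preimage, Set.mem_univ_pi, Function.comp_apply]
    constructor
    · intro h j
      by_cases hj : ∃ i, k i = j
      · obtain ⟨i, rfl⟩ := hj
        rw [hk.extend_apply]
        exact h i
      · rw [Function.extend_apply' _ _ _ hj]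
        trivial
    · intro h i
      have := h (k i)
      rwa [hk.extend_apply] at this
  rw [hpre, Measure.pi_pi, ← Finset.prod_subset (Finset.subset_univ (Finset.univ.image k)),
    Finset.prod_image hk.injOn]
  · exact Finset.prod_congr rfl fun i _ => by rw [hk.extend_apply]
  · intro j _ hj
    rw [Function.extend_apply' _ _ _ (by simpa using hj), measure_univ]

theorem runMeasure_real_eq {n : ℕ} {E : Set (Outcome n)} (hE : MeasurableSet E) :
    (runMeasure n).real E = (∑ π : Ports n,
      (Measure.pi fun _ : Fin n => tapeMeasure).real (Prod.mk π ⁻¹' E)) / Fintype.card (Ports n) := by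
  rw [Measure.real, runMeasure, Measure.prod_apply hE, lintegral_fintype,
    ENNReal.toReal_sum (fun π _ => ENNReal.mul_ne_top (measure_ne_top _ _) (measure_ne_top _ _)),
    Finset.sum_div]
  refine Finset.sum_congr rfl fun π _ => ?_
  rw [PMF.toMeasure_apply_singleton _ _ (MeasurableSet.singleton π), PMF.uniformOfFintype_apply,
    ENNReal.toReal_mul, ENNReal.toReal_inv, ENNReal.toReal_natCast, div_eq_mul_inv, Measure.real]

namespace Algorithm

attribute [local instance] measurableSpaceState countableMsg

variable {n : ℕ} {I : Type} (A : Algorithm n I) (ids : Fin n → I)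

/-- The event that at time `t` exactly one node is elected and all others are non-elected. -/
def leaderAt (t : ℕ) : Set (Outcome n) :=
  {x | ∃ v, A.status (A.state ids x t v) = Status.elected ∧
    ∀ w, w ≠ v → A.status (A.state ids x t w) = Status.nonElected}

/-- The event that at most `m` messages are sent in the first `t` rounds. -/
def cheapUntil (t m : ℕ) : Set (Outcome n) :=
  {x | A.messages ids x t ≤ m}

/-- `recv` is measurable only for each fixed inbox; as there are countably many inboxes, the
preimage splits accordingly. -/
theorem measurable_recv_of_countable {Y : Type*} [MeasurableSpace Y] {g : Y → A.State}
    (hg : Measurable g) {b : Y → Fin (n - 1) → Option A.Msg}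
    (hb : ∀ p c, MeasurableSet {y | b y p = c}) :
    Measurable fun y => A.recv (g y) (b y) := by
  intro B hB
  have : (fun y => A.recv (g y) (b y)) ⁻¹' B = ⋃ c : Fin (n - 1) → Option A.Msg,
      (⋂ p, {y | b y p = c p}) ∩ {y | A.recv (g y) c ∈ B} := by
    ext y
    simp only [Set.mem_preimage, Set.mem_iUnion, Set.mem_inter_iff, Set.mem_iInter]
    constructor
    · intro h
      exact ⟨b y, fun p => rfl, h⟩
    · rintro ⟨c, hc, h⟩
      have : b y = c := funext hc
      subst this
      exact h
  rw [this]
  exact MeasurableSet.iUnion fun c => (MeasurableSet.iInter fun p => hb p (c p)).inter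
    (((A.measurable_recv c).comp hg) hB)

theorem measurable_state (π : Ports n) (t : ℕ) (v : Fin n) :
    Measurable fun τ : Fin n → Tape => A.state ids (π, τ) t v := by
  induction t generalizing v with
  | zero => exact (A.measurable_init (ids v)).comp (measurable_pi_apply v)
  | succ t ih =>
    exact A.measurable_recv_of_countable (ih v) fun p c =>
      ih (π v p) (A.measurableSet_send ((π (π v p)).symm ⟨v, (π v p).2.symm⟩) c)

theorem measurableSet_of_sections {E : Set (Outcome n)}
    (h : ∀ π, MeasurableSet (Prod.mk π ⁻¹' E)) : MeasurableSet E := by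
  have : E = ⋃ π, ({π} : Set (Ports n)) ×ˢ (Prod.mk π ⁻¹' E) := by
    ext ⟨π, τ⟩
    simp
  rw [this]
  exact MeasurableSet.iUnion fun π => (MeasurableSet.singleton π).prod (h π)

theorem measurableSet_leaderAt (t : ℕ) : MeasurableSet (A.leaderAt ids t) := by
  refine measurableSet_of_sections fun π => ?_
  have hs : ∀ v y, MeasurableSet {τ : Fin n → Tape | A.status (A.state ids (π, τ) t v) = y} :=
    fun v y => A.measurable_state ids π t v (A.measurableSet_status y)
  have : Prod.mk π ⁻¹' A.leaderAt ids t =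
      ⋃ v, {τ | A.status (A.state ids (π, τ) t v) = Status.elected} ∩
        ⋂ w, ⋂ _ : w ≠ v, {τ | A.status (A.state ids (π, τ) t w) = Status.nonElected} := by
    ext τ
    simp [leaderAt]
  rw [this]
  exact MeasurableSet.iUnion fun v => (hs v _).inter
    (MeasurableSet.iInter fun w => MeasurableSet.iInter fun _ => hs w _)

theorem measurableSet_cheapUntil (t m : ℕ) : MeasurableSet (A.cheapUntil ids t m) := by
  refine measurableSet_of_sections fun π => ?_
  have : Measurable fun τ : Fin n → Tape => A.messages ids (π, τ) t := by
    simp only [messages, Finset.card_filter]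
    refine Finset.measurable_sum _ fun r _ => Finset.measurable_sum _ fun v _ =>
      Finset.measurable_sum _ fun p _ => Measurable.ite ?_ measurable_const measurable_const
    have h := A.measurable_state ids π r v (A.measurableSet_send p none)
    convert h.compl using 1
    ext τ
    simp [Option.isSome_iff_ne_none]
  exact this (measurableSet_Iic (a := m))

/-- Continuity from below: the events of being settled from round `T` on increase to `electsLeader`.
The strict inequality buys a deterministic time. -/
theorem exists_forall_leaderAt {δ : ℝ} (hδ : δ < (runMeasure n).real (A.electsLeader ids)) :
    ∃ T, ∀ t, T ≤ t → δ ≤ (runMeasure n).real (A.leaderAt ids t) := by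
  have hU : A.electsLeader ids = ⋃ T, ⋂ t, ⋂ _ : T ≤ t, A.leaderAt ids t := by
    ext x
    simp [electsLeader, leaderAt]
  have hmono : Monotone fun T => ⋂ t, ⋂ _ : T ≤ t, A.leaderAt ids t := by
    intro T T' h x hx
    simp only [Set.mem_iInter] at hx ⊢
    exact fun t ht => hx t (h.trans ht)
  have hlim := tendsto_measure_iUnion_atTop (μ := runMeasure n) hmono
  rw [← hU] at hlim
  have hlim' := (ENNReal.tendsto_toReal (measure_ne_top _ _)).comp hlim
  obtain ⟨T, hT⟩ := (hlim'.eventually (lt_mem_nhds hδ)).exists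
  refine ⟨T, fun t ht => hT.le.trans ?_⟩
  exact measureReal_mono (Set.iInter₂_subset t ht)

theorem le_real_leaderAt_inter_cheapUntil {t m : ℕ} {p q : ℝ}
    (hp : p ≤ (runMeasure n).real (A.leaderAt ids t))
    (hq : q ≤ (runMeasure n).real (A.cheapUntil ids t m)) :
    p + q - 1 ≤ (runMeasure n).real (A.leaderAt ids t ∩ A.cheapUntil ids t m) := by
  have h := measureReal_union_add_inter (μ := runMeasure n) (s := A.leaderAt ids t)
    (A.measurableSet_cheapUntil ids t m)
  have h1 : (runMeasure n).real (A.leaderAt ids t ∪ A.cheapUntil ids t m) ≤ 1 :=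
    measureReal_le_one
  linarith

theorem sendsAtMost_subset_cheapUntil (b : ℝ) (t : ℕ) :
    A.sendsAtMost ids b ⊆ A.cheapUntil ids t ⌊b⌋₊ :=
  fun _ hx => Nat.le_floor (hx t)

/-! ### From tapes and identifiers to a finite pool of seeds -/

section Sampling

variable {N : ℕ} (ι : Fin N → I) (s : Fin N → Tape)

theorem state_eq_run (k : Fin n → Fin N) (π : Ports n) (t : ℕ) (v : Fin n) :
    A.state (ι ∘ k) (π, s ∘ k) t v =
      A.run (fun j => A.init (ι j) (s j)) (fun v => (k v, π v)) t v := by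
  induction t generalizing v with
  | zero => rfl
  | succ t ih =>
    simp only [state, run, ih]
    rfl

theorem mem_leaderAt_inter_cheapUntil_iff (k : Fin n → Fin N) (π : Ports n) (t m : ℕ) :
    (π, s ∘ k) ∈ A.leaderAt (ι ∘ k) t ∩ A.cheapUntil (ι ∘ k) t m ↔
      ElectsCheaply A (fun j => A.init (ι j) (s j)) t m (fun v => (k v, π v)) := by
  simp only [leaderAt, cheapUntil, ElectsCheaply, Set.mem_inter_iff, Set.mem_ofPred_eq, messages,
    sent, sentBy, state_eq_run]

open Classical in
theorem card_leaderAt_inter_cheapUntil_le {t m : ℕ} (hmn : 2 * m + 1 < n) :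
    ((Finset.univ.filter fun y : Ports n × (Fin n → Fin N) =>
      (y.1, s ∘ y.2) ∈ A.leaderAt (ι ∘ y.2) t ∩ A.cheapUntil (ι ∘ y.2) t m).card : ℝ) ≤
        (2 * (3 * m + 1) ^ 2 / (n - 1) + n / (n - 1) * Real.exp (-1)) *
          (Fintype.card (Ports n) * N ^ n) := by
  let e : Ports n × (Fin n → Fin N) ≃ Config n (Fin N) :=
    { toFun := fun y v => (y.2 v, y.1 v)
      invFun := fun x => (fun v => (x v).2, fun v => (x v).1)
      left_inv := fun _ => rfl
      right_inv := fun _ => rfl }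
  have h := card_electsCheaply_le (A := A) (s₀ := fun j => A.init (ι j) (s j)) (t := t) hmn
  have hc : Fintype.card (Config n (Fin N)) = Fintype.card (Ports n) * N ^ n := by
    rw [← Fintype.card_congr e, Fintype.card_prod]
    simp
  rw [hc] at h
  push_cast at h
  refine le_trans (Nat.cast_le.2 ?_) h
  refine Finset.card_le_card_of_injOn e (fun y hy => ?_) e.injective.injOn
  simp only [Finset.coe_filter, Finset.mem_univ, true_and, Set.mem_ofPred_eq] at hy ⊢
  exact (A.mem_leaderAt_inter_cheapUntil_iff ι s y.2 y.1 t m).1 hy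

/-- If the nodes elect a leader cheaply with probability at least `θ`, for every choice of distinct
inputs from a list, then the probability `θ` is small. -/
theorem mul_descFactorial_le {t m : ℕ} (hmn : 2 * m + 1 < n) {θ : ℝ}
    (hθ : ∀ k : Fin n → Fin N, Function.Injective k →
      θ ≤ (runMeasure n).real (A.leaderAt (ι ∘ k) t ∩ A.cheapUntil (ι ∘ k) t m)) :
    θ * N.descFactorial n ≤
      (2 * (3 * m + 1) ^ 2 / (n - 1) + n / (n - 1) * Real.exp (-1)) * N ^ n := by
  classical
  set b : ℝ := 2 * (3 * m + 1) ^ 2 / (n - 1) + n / (n - 1) * Real.exp (-1) with hb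
  let E : (Fin n → Fin N) → Set (Outcome n) := fun k =>
    A.leaderAt (ι ∘ k) t ∩ A.cheapUntil (ι ∘ k) t m
  have hE : ∀ k, MeasurableSet (E k) := fun k =>
    (A.measurableSet_leaderAt _ t).inter (A.measurableSet_cheapUntil _ t m)
  let μ : Measure (Fin N → Tape) := Measure.pi fun _ => tapeMeasure
  let B : Ports n × (Fin n → Fin N) → Set (Fin N → Tape) := fun y => {s | (y.1, s ∘ y.2) ∈ E y.2}
  have hcomp : ∀ k : Fin n → Fin N, Measurable fun s : Fin N → Tape => s ∘ k := fun k =>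
    measurable_pi_lambda _ fun i => measurable_pi_apply (k i)
  have hB : ∀ y, MeasurableSet (B y) := fun y =>
    (measurable_const.prodMk (hcomp y.2)) (hE y.2)
  have hcard : (0 : ℝ) < Fintype.card (Ports n) := by exact_mod_cast Fintype.card_pos
  -- For every fixed pool `s` the finite bound limits the number of successful pairs of ports and
  -- draws; integrate over `s`.
  have hsum : ∑ y, μ.real (B y) ≤ b * (Fintype.card (Ports n) * N ^ n) := by
    have hintegrable : ∀ y ∈ Finset.univ, Integrable ((B y).indicator (1 : (Fin N → Tape) → ℝ)) μ :=
      fun y _ => (integrable_const (1 : ℝ)).indicator (hB y)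
    calc ∑ y, μ.real (B y) = ∫ s, ∑ y, (B y).indicator (1 : (Fin N → Tape) → ℝ) s ∂μ := by
          rw [integral_finsetSum _ hintegrable]
          exact Finset.sum_congr rfl fun y _ => (integral_indicator_one (hB y)).symm
      _ ≤ ∫ _, b * (Fintype.card (Ports n) * N ^ n) ∂μ := by
          refine integral_mono (integrable_finsetSum _ hintegrable) (integrable_const _) fun s => ?_
          refine le_trans (le_of_eq ?_) (A.card_leaderAt_inter_cheapUntil_le ι s (t := t) hmn)
          rw [Finset.card_filter]
          push_cast
          refine Finset.sum_congr rfl fun y _ => ?_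
          simp [Set.indicator_apply, B, E]
      _ = b * (Fintype.card (Ports n) * N ^ n) := by simp
  -- Through an injective draw the pool shows `n` independent tapes, so the hypothesis on genuine
  -- runs applies. Other draws are only bounded below by zero.
  have hinj : ∀ k : Fin n → Fin N, Function.Injective k →
      θ * Fintype.card (Ports n) ≤ ∑ π, μ.real (B (π, k)) := by
    intro k hk
    have h := hθ k hk
    rw [runMeasure_real_eq (hE k), le_div_iff₀ hcard] at h
    refine h.trans (le_of_eq (Finset.sum_congr rfl fun π _ => ?_))
    exact ((measurePreserving_comp_injective tapeMeasure hk).measureReal_preimage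
      (measurable_prodMk_left (hE k)).nullMeasurableSet).symm
  have hcnt : (Finset.univ.filter fun k : Fin n → Fin N => Function.Injective k).card =
      N.descFactorial n := by
    have := Fintype.card_embedding_eq (α := Fin n) (β := Fin N)
    rw [Fintype.card_fin, Fintype.card_fin] at this
    rw [← this, ← Fintype.card_subtype]
    exact Fintype.card_congr (Equiv.subtypeInjectiveEquivEmbedding _ _)
  have hle : θ * N.descFactorial n * Fintype.card (Ports n) ≤
      b * N ^ n * Fintype.card (Ports n) := by
    calc θ * N.descFactorial n * Fintype.card (Ports n)
        = ∑ _k ∈ Finset.univ.filter fun k : Fin n → Fin N => Function.Injective k,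
            θ * Fintype.card (Ports n) := by
          rw [Finset.sum_const, hcnt, nsmul_eq_mul]
          ring
      _ ≤ ∑ k ∈ Finset.univ.filter fun k : Fin n → Fin N => Function.Injective k,
            ∑ π, μ.real (B (π, k)) :=
          Finset.sum_le_sum fun k hk => hinj k (Finset.mem_filter.1 hk).2
      _ ≤ ∑ k, ∑ π, μ.real (B (π, k)) :=
          Finset.sum_le_sum_of_subset_of_nonneg (Finset.subset_univ _) fun k _ _ =>
            Finset.sum_nonneg fun π _ => measureReal_nonneg
      _ = ∑ y, μ.real (B y) := by rw [Finset.sum_comm, Fintype.sum_prod_type]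
      _ ≤ b * (Fintype.card (Ports n) * N ^ n) := hsum
      _ = _ := by ring
  exact le_of_mul_le_mul_right hle hcard

end Sampling

end Algorithm

/-! ### Asymptotics and conclusion -/

theorem one_sub_mul_pow_le_descFactorial {n N : ℕ} (hn : n ≤ N) (hN : 0 < N) :
    (1 - (n : ℝ) ^ 2 / N) * N ^ n ≤ N.descFactorial n := by
  have hNr : (0 : ℝ) < N := by exact_mod_cast hN
  have hnN : (n : ℝ) / N ≤ 1 := (div_le_one hNr).2 (by exact_mod_cast hn)
  have h1 : (((N - n) ^ n : ℕ) : ℝ) ≤ N.descFactorial n :=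
    Nat.cast_le.2 ((Nat.pow_le_pow_left (by omega) n).trans (Nat.pow_sub_le_descFactorial N n))
  refine le_trans ?_ h1
  -- Bernoulli: `(1 - n / N) ^ n ≥ 1 - n ^ 2 / N`.
  have h2 := one_add_mul_le_pow (a := -((n : ℝ) / N)) (by linarith) n
  push_cast [Nat.cast_sub hn]
  calc (1 - (n : ℝ) ^ 2 / N) * N ^ n = (1 + n * -((n : ℝ) / N)) * N ^ n := by ring
    _ ≤ (1 + -((n : ℝ) / N)) ^ n * N ^ n := by gcongr
    _ = ((N : ℝ) - n) ^ n := by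
        rw [← mul_pow]
        congr 1
        field_simp
        ring

theorem exists_embedding_of_le_card {N : ℕ} {X : Type} (h : (N : ℕ∞) ≤ ENat.card X) :
    Nonempty (Fin N ↪ X) := by
  have : (N : Cardinal) ≤ Cardinal.mk X := Cardinal.natCast_le_toENat.1 h
  rwa [← Cardinal.mk_fin, Cardinal.le_def] at this

/-- The bound holds as soon as, for all large `n`, there is a list of `n ^ 4` inputs such that the
hypotheses hold whenever the nodes get distinct entries of this list. -/
theorem exists_mul_sqrt_le {I : ℕ → Type} (A : ∀ n, Algorithm n (I n)) (f : ℕ → ℝ) {ε a : ℝ}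
    (hε : 0 < ε) (ha : 0 < a)
    (h : ∀ᶠ n : ℕ in atTop, ∃ ι : Fin (n ^ 4) → I n, ∀ k : Fin n → Fin (n ^ 4),
      Function.Injective k →
        1 - 1 / (n : ℝ) ^ a ≤ (runMeasure n).real ((A n).sendsAtMost (ι ∘ k) (f n)) ∧
        1 / Real.exp 1 + ε ≤ (runMeasure n).real ((A n).electsLeader (ι ∘ k))) :
    ∃ c : ℝ, 0 < c ∧ ∀ᶠ n : ℕ in atTop, c * √(n : ℝ) ≤ f n := by
  -- If `m ≤ √ε / 12 * √n`, then `2 * (3 * m + 1) ^ 2 ≤ 36 * m ^ 2 + 4 ≤ ε / 4 * n + 4`. In the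
  -- limit this leaves `1 / e + ε / 4` against the assumed `1 / e + ε / 2`.
  refine ⟨√ε / 12, by positivity, ?_⟩
  have hc2 : (√ε / 12) ^ 2 = ε / 144 := by
    rw [div_pow, Real.sq_sqrt hε.le]
    norm_num
  have hinv : Tendsto (fun n : ℕ => 1 / (n : ℝ)) atTop (nhds 0) :=
    tendsto_one_div_atTop_nhds_zero_nat
  have hpow : Tendsto (fun n : ℕ => 1 / (n : ℝ) ^ a) atTop (nhds 0) := by
    simp only [one_div]
    exact ((tendsto_rpow_atTop ha).comp tendsto_natCast_atTop_atTop).inv_tendsto_atTop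
  have hL : Tendsto (fun n : ℕ => (Real.exp (-1) + ε / 2 - 1 / (n : ℝ) ^ a) *
      (1 - (1 / (n : ℝ)) ^ 2)) atTop (nhds ((Real.exp (-1) + ε / 2 - 0) * (1 - 0 ^ 2))) :=
    (tendsto_const_nhds.sub hpow).mul (tendsto_const_nhds.sub (hinv.pow 2))
  have hR : Tendsto (fun n : ℕ => (ε / 4 + Real.exp (-1) + 4 * (1 / (n : ℝ))) /
      (1 - 1 / (n : ℝ))) atTop (nhds ((ε / 4 + Real.exp (-1) + 4 * 0) / (1 - 0))) :=
    (tendsto_const_nhds.add (hinv.const_mul 4)).div (tendsto_const_nhds.sub hinv) (by norm_num)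
  have hlt := hR.eventually_lt hL (by simp; linarith)
  have hsmall : ∀ᶠ n : ℕ in atTop, ε ≤ n := tendsto_natCast_atTop_atTop.eventually_ge_atTop ε
  filter_upwards [h, hlt, eventually_ge_atTop 3, hsmall] with n hn hlt hn3 hεn
  by_contra! hf
  obtain ⟨ι, hι⟩ := hn
  set m := ⌊f n⌋₊ with hm
  have hn3r : (3 : ℝ) ≤ n := by exact_mod_cast hn3
  have hn0 : (0 : ℝ) < n := by linarith
  have hmle : (m : ℝ) ≤ √ε / 12 * √n := by
    rcases le_or_gt 0 (f n) with h0 | h0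
    · exact (Nat.floor_le h0).trans hf.le
    · rw [hm, Nat.floor_of_nonpos h0.le]
      simp only [Nat.cast_zero]
      positivity
  have hm2 : (m : ℝ) ^ 2 ≤ ε / 144 * n := by
    calc (m : ℝ) ^ 2 ≤ (√ε / 12 * √n) ^ 2 := by gcongr
      _ = ε / 144 * n := by rw [mul_pow, hc2, Real.sq_sqrt hn0.le]
  have hmn : 2 * m + 1 < n := by
    have h12 : (m : ℝ) ≤ n / 12 := by
      refine le_of_sq_le_sq ?_ (by positivity)
      nlinarith
    have : ((2 * m + 1 : ℕ) : ℝ) < n := by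
      push_cast
      linarith
    exact_mod_cast this
  -- The time depends on the inputs, but there are finitely many draws `k`, so a supremum gives one
  -- `t` for all. Injectivity stands inside the existential so that `T` is defined for every `k`.
  have hTk : ∀ k : Fin n → Fin (n ^ 4), ∃ T, Function.Injective k → ∀ t, T ≤ t →
      Real.exp (-1) + ε / 2 ≤ (runMeasure n).real ((A n).leaderAt (ι ∘ k) t) := by
    intro k
    by_cases hk : Function.Injective k
    · have hE := (hι k hk).2
      rw [one_div, ← Real.exp_neg] at hE
      obtain ⟨T, hT⟩ := (A n).exists_forall_leaderAt (ι ∘ k)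
        (δ := Real.exp (-1) + ε / 2) (by linarith)
      exact ⟨T, fun _ => hT⟩
    · exact ⟨0, fun h => absurd h hk⟩
  choose T hT using hTk
  let t := Finset.univ.sup T
  have hθ : ∀ k : Fin n → Fin (n ^ 4), Function.Injective k →
      Real.exp (-1) + ε / 2 - 1 / (n : ℝ) ^ a ≤ (runMeasure n).real
        ((A n).leaderAt (ι ∘ k) t ∩ (A n).cheapUntil (ι ∘ k) t m) := by
    intro k hk
    have h1 := hT k hk t (Finset.le_sup (Finset.mem_univ k))
    have h2 := (hι k hk).1.trans
      (measureReal_mono ((A n).sendsAtMost_subset_cheapUntil (ι ∘ k) (f n) t))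
    have := (A n).le_real_leaderAt_inter_cheapUntil (ι ∘ k) h1 h2
    linarith
  have hmain := (A n).mul_descFactorial_le ι hmn hθ
  have hN : 0 < n ^ 4 := by positivity
  have hdesc := one_sub_mul_pow_le_descFactorial (Nat.le_self_pow (by norm_num) n : n ≤ n ^ 4) hN
  have hdesc' : (1 - (1 / (n : ℝ)) ^ 2) * ((n ^ 4 : ℕ) : ℝ) ^ n ≤ (n ^ 4).descFactorial n := by
    refine le_trans (le_of_eq ?_) hdesc
    congr 2
    push_cast
    field_simp
  have hbound : 2 * (3 * (m : ℝ) + 1) ^ 2 / (n - 1) + n / (n - 1) * Real.exp (-1) ≤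
      (ε / 4 + Real.exp (-1) + 4 * (1 / (n : ℝ))) / (1 - 1 / (n : ℝ)) := by
    have h1 : (0 : ℝ) < n - 1 := by linarith
    have : (ε / 4 + Real.exp (-1) + 4 * (1 / (n : ℝ))) / (1 - 1 / (n : ℝ)) =
        (ε / 4 * n + 4 + n * Real.exp (-1)) / (n - 1) := by
      have : 1 - 1 / (n : ℝ) = (n - 1) / n := by field_simp
      rw [this]
      field_simp
      ring
    rw [this, div_mul_eq_mul_div, ← add_div]
    gcongr
    nlinarith [sq_nonneg (3 * (m : ℝ) - 1)]
  have hNn : (0 : ℝ) < ((n ^ 4 : ℕ) : ℝ) ^ n := by positivity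
  have hright : (0 : ℝ) < (ε / 4 + Real.exp (-1) + 4 * (1 / (n : ℝ))) / (1 - 1 / (n : ℝ)) := by
    have : (1 : ℝ) / n ≤ 1 / 3 := by gcongr
    exact div_pos (by positivity) (by linarith)
  have hsq : (0 : ℝ) ≤ 1 - (1 / (n : ℝ)) ^ 2 := by
    have h1 : (1 : ℝ) / n ≤ 1 / 3 := by gcongr
    have h2 : (0 : ℝ) ≤ 1 / n := by positivity
    nlinarith
  -- Monotonicity of multiplication by this factor needs its sign, which follows from `hlt`, since
  -- the right-hand bound is positive.
  have hθpos : 0 ≤ Real.exp (-1) + ε / 2 - 1 / (n : ℝ) ^ a := by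
    by_contra! hneg
    have := mul_nonpos_of_nonpos_of_nonneg hneg.le hsq
    linarith
  have hfin : (Real.exp (-1) + ε / 2 - 1 / (n : ℝ) ^ a) * (1 - (1 / (n : ℝ)) ^ 2) *
      ((n ^ 4 : ℕ) : ℝ) ^ n ≤ (ε / 4 + Real.exp (-1) + 4 * (1 / (n : ℝ))) / (1 - 1 / (n : ℝ)) *
        ((n ^ 4 : ℕ) : ℝ) ^ n := by
    calc _ = (Real.exp (-1) + ε / 2 - 1 / (n : ℝ) ^ a) *
          ((1 - (1 / (n : ℝ)) ^ 2) * ((n ^ 4 : ℕ) : ℝ) ^ n) := by ring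
      _ ≤ (Real.exp (-1) + ε / 2 - 1 / (n : ℝ) ^ a) * (n ^ 4).descFactorial n := by gcongr
      _ ≤ _ := hmain
      _ ≤ _ := by gcongr
  exact absurd (le_of_mul_le_mul_right hfin hNn) (not_le.2 hlt)

end LeaderElection

theorem theorem3 :
    -- anonymous nodes
    (∀ (A : ∀ n : ℕ, LeaderElection.Algorithm n Unit) (f : ℕ → ℝ) (ε a : ℝ), 0 < ε → 0 < a →
      (∀ᶠ n : ℕ in atTop, 1 - 1 / (n : ℝ) ^ a ≤
        (LeaderElection.runMeasure n).real ((A n).sendsAtMost (fun _ => ()) (f n))) →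
      (∀ᶠ n : ℕ in atTop, 1 / Real.exp 1 + ε ≤
        (LeaderElection.runMeasure n).real ((A n).electsLeader (fun _ => ()))) →
      ∃ c : ℝ, 0 < c ∧ ∀ᶠ n : ℕ in atTop, c * √(n : ℝ) ≤ f n) ∧
    -- unique identifiers, chosen by an adversary from a set of at least `n ^ 4` identifiers
    (∀ (I : ℕ → Type), (∀ᶠ n : ℕ in atTop, ((n ^ 4 : ℕ) : ℕ∞) ≤ ENat.card (I n)) →
      ∀ (A : ∀ n : ℕ, LeaderElection.Algorithm n (I n)) (f : ℕ → ℝ) (ε a : ℝ), 0 < ε → 0 < a →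
      (∀ᶠ n : ℕ in atTop, ∀ ids : Fin n ↪ I n, 1 - 1 / (n : ℝ) ^ a ≤
        (LeaderElection.runMeasure n).real ((A n).sendsAtMost ids (f n))) →
      (∀ᶠ n : ℕ in atTop, ∀ ids : Fin n ↪ I n, 1 / Real.exp 1 + ε ≤
        (LeaderElection.runMeasure n).real ((A n).electsLeader ids)) →
      ∃ c : ℝ, 0 < c ∧ ∀ᶠ n : ℕ in atTop, c * √(n : ℝ) ≤ f n) := by
  constructor
  · intro A f ε a hε ha hsend helect
    refine LeaderElection.exists_mul_sqrt_le A f hε ha ?_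
    filter_upwards [hsend, helect] with n h1 h2
    exact ⟨fun _ => (), fun k _ => ⟨h1, h2⟩⟩
  · intro I hI A f ε a hε ha hsend helect
    refine LeaderElection.exists_mul_sqrt_le A f hε ha ?_
    filter_upwards [hI, hsend, helect] with n hcard h1 h2
    obtain ⟨e⟩ := LeaderElection.exists_embedding_of_le_card hcard
    exact ⟨e, fun k hk => ⟨h1 ⟨e ∘ k, e.injective.comp hk⟩, h2 ⟨e ∘ k, e.injective.comp hk⟩⟩⟩
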